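/- Let $(\mathcal M,\mathfrak g)$ be a finite-dimensional smooth Riemannian manifold without boundary, geodesically complete, so that $\mathrm{Exp}_x$ is defined on all of $T_x\mathcal M$. For a curve $\gamma$, let parallel transport along $\gamma$ be that of the Levi-Civita connection. Let $L>0$ and let $f_1,\dots,f_n:\mathcal M\to\mathbb R$ be differentiable and geodesically $L$-smooth: for every geodesic $\gamma:[0,1]\to\mathcal M$ with $x=\gamma(0)$, $y=\gamma(1)$ (so $\dot\gamma(0)=\mathrm{Exp}_x^{-1}(y)$ when geodesics are unique), $$\|\nabla f_i(x)-\Gamma_y^x\nabla f_i(y)\|\le L\|\dot\gamma(0)\|,$$ where $\Gamma_y^x$ is parallel transport along $\gamma$ from $y$ to $x$. Let $f=\frac1n\sum_{i=1}^n f_i$, let $f^*\in\mathbb R$ satisfy $f(x)\ge f^*$ for all $x\in\mathcal M$, let $x^0\in\mathcal M$ and $\delta^0=f(x^0)-f^*$. Let $b$ be an integer with $1\le b\le\sqrt n$, and put $$p=\frac{b}{n+b},\qquad \eta=\frac{1}{L\left(1+\sqrt{\frac{1-p}{pb}}\right)}.$$ The R-PAGE method with large minibatch size $B=n$ starts with $g^0=\nabla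 f(x^0)$ and iterates $x^{k+1}=\mathrm{Exp}_{x^k}(-\eta g^k)$ and, with fresh independent randomness in each iteration, $$g^{k+1}=\begin{cases}\nabla f(x^{k+1}) & \text{with probability } p,\\ \Gamma_{x^k}^{x^{k+1}}g^k+\frac1b\sum_{i\in I_k}\nabla f_i(x^{k+1})-\Gamma_{x^k}^{x^{k+1}}\Big(\frac1b\sum_{i\in I_k}\nabla f_i(x^k)\Big) & \text{otherwise,}\end{cases}$$ where $I_k$ is a uniformly random $b$-element subset of $\{1,\dots,n\}$ and $\Gamma_{x^k}^{x^{k+1}}$ is parallel transport along the geodesic $t\mapsto\mathrm{Exp}_{x^k}(-t\eta g^k)$, $0\le t\le 1$. For $K\ge1$ let $\widehat x^K$ be chosen uniformly at random from $x^0,\dots,x^{K-1}$, independently of everything else. Then for every $\varepsilon>0$ there is a number of iterations $K\ge1$ such that $$\mathbb E\big[\|\nabla f(\widehat x^K)\|\big]\le\varepsilon,$$ and the expected number $\#\mathrm{grad}$ of evaluations of component gradients $\nabla f_i$ in the initialization and $K$ iterations ($n$ for each full gradient and $2b$ for each minibatch update) satisfies $$\#\mathrm{grad}\le 12\left(n+\frac{L\delta^0\sqrt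 n}{\varepsilon^2}\right).$$ In particular $\#\mathrm{grad}=\mathcal O\left(n+\frac{\sqrt n}{\varepsilon^2}\right)$ for fixed $L$ and $\delta^0$. -/

import Mathlib

open Bundle Manifold MeasureTheory ProbabilityTheory
open scoped ContDiff

noncomputable section

namespace RPAGE

section Geometry

variable {E : Type*} [NormedAddCommGroup E] [NormedSpace ℝ E]
  {M : Type*} [TopologicalSpace M] [ChartedSpace E M] [IsManifold 𝓘(ℝ, E) ∞ M]

/-- The velocity `γ'(t) ∈ T_{γ t} M` of a curve. -/
def velocity (γ : ℝ → M) (t : ℝ) : TangentSpace 𝓘(ℝ, E) (γ t) :=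
  mfderiv 𝓘(ℝ, ℝ) 𝓘(ℝ, E) γ t (1 : ℝ)

/-- Components in `E` of a tangent vector `v ∈ T_p M`, with respect to the chart at `x₀`
(meaningful when `p` lies in the domain of this chart). -/
def coords (x₀ p : M) (v : TangentSpace 𝓘(ℝ, E) p) : E :=
  (trivializationAt E (TangentSpace 𝓘(ℝ, E)) x₀).continuousLinearMapAt ℝ p v

/-- The tangent vector at `p` with components `u` with respect to the chart at `x₀`. -/
def ofCoords (x₀ p : M) (u : E) : TangentSpace 𝓘(ℝ, E) p :=
  (trivializationAt E (TangentSpace 𝓘(ℝ, E)) x₀).symmL ℝ p u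

variable [RiemannianBundle (fun x : M ↦ TangentSpace 𝓘(ℝ, E) x)]

/-- The metric tensor `g_{ij}(y) uⁱ wʲ` in the chart at `x₀`. -/
def metricInChart (x₀ : M) (y u w : E) : ℝ :=
  inner ℝ (ofCoords x₀ ((extChartAt 𝓘(ℝ, E) x₀).symm y) u)
    (ofCoords x₀ ((extChartAt 𝓘(ℝ, E) x₀).symm y) w)

/-- The derivative `∂_a g_{ij} uⁱ wʲ` of the metric tensor in the chart at `x₀`, at `x₀`. -/
def metricDeriv (x₀ : M) (a u w : E) : ℝ :=
  fderiv ℝ (fun y ↦ metricInChart x₀ y u w) (extChartAt 𝓘(ℝ, E) x₀ x₀) a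

/-- The Christoffel symbols of the first kind of the Levi-Civita connection, contracted with
`u`, `v`, `w`: `Γ_{k,ij} uⁱ vʲ wᵏ = ½ (∂_i g_{jk} + ∂_j g_{ik} - ∂_k g_{ij}) uⁱ vʲ wᵏ`,
in the chart at `x₀`, at the point `x₀`. -/
def christoffelFirst (x₀ : M) (u v w : E) : ℝ :=
  (metricDeriv x₀ u v w + metricDeriv x₀ v u w - metricDeriv x₀ w u v) / 2

/-- `V` is a parallel vector field along `γ` over the time set `S`: its covariant derivative
`D_t V` vanishes. At each time `t` this is expressed in the chart at `γ t`, with lowered index: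
`g(V̇, w) + Γ(γ̇, V, w) = 0` for all `w`. -/
def IsParallelOn (γ : ℝ → M) (V : ∀ t, TangentSpace 𝓘(ℝ, E) (γ t)) (S : Set ℝ) : Prop :=
  ∀ t ∈ S, ∃ v' : E,
    HasDerivWithinAt (fun s ↦ coords (γ t) (γ s) (V s)) v' S t ∧
    ∀ w : E, metricInChart (γ t) (extChartAt 𝓘(ℝ, E) (γ t) (γ t)) v' w +
      christoffelFirst (γ t) (coords (γ t) (γ t) (velocity γ t)) (coords (γ t) (γ t) (V t)) w = 0

/-- A (complete) geodesic: a smooth curve with parallel velocity, `D_t γ' = 0`. -/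
def IsGeodesic (γ : ℝ → M) : Prop :=
  ContMDiff 𝓘(ℝ, ℝ) 𝓘(ℝ, E) ∞ γ ∧ IsParallelOn (E := E) γ (velocity γ) Set.univ

/-- `γ` is the geodesic with `γ(0) = x` and `γ'(0) = v`, where `(x, v)` is a point of `TM`. -/
def IsGeodesicFrom (γ : ℝ → M) (xv : TangentBundle 𝓘(ℝ, E) M) : Prop :=
  IsGeodesic (E := E) γ ∧ (⟨γ 0, velocity γ 0⟩ : TangentBundle 𝓘(ℝ, E) M) = xv

variable (E M) in
/-- Geodesic completeness: `Exp_x` is defined on all of `T_x M`, for every `x`. -/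
def IsGeodesicallyComplete : Prop :=
  ∀ xv : TangentBundle 𝓘(ℝ, E) M, ∃ γ : ℝ → M, IsGeodesicFrom γ xv

open Classical in
/-- The geodesic `t ↦ Exp_x(t v)`. -/
def expCurve (xv : TangentBundle 𝓘(ℝ, E) M) : ℝ → M :=
  if h : ∃ γ : ℝ → M, IsGeodesicFrom γ xv then h.choose else fun _ ↦ xv.proj

/-- The Riemannian exponential map `Exp_x(v)`. -/
def riemExp (xv : TangentBundle 𝓘(ℝ, E) M) : M := expCurve xv 1

open Classical in
/-- Parallel transport along `γ` from `γ a` to `γ b` of a tangent vector `u` based at `γ a`: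
the value at time `b` of the parallel field along `γ` whose value at time `a` is `u`. -/
def parallelTransport (γ : ℝ → M) (a b : ℝ) (u : TangentBundle 𝓘(ℝ, E) M) :
    TangentSpace 𝓘(ℝ, E) (γ b) :=
  if h : ∃ V : ∀ t, TangentSpace 𝓘(ℝ, E) (γ t), IsParallelOn γ V (Set.uIcc a b) ∧
      (⟨γ a, V a⟩ : TangentBundle 𝓘(ℝ, E) M) = u
  then h.choose b else 0

variable [FiniteDimensional ℝ E]

instance (x : M) : FiniteDimensional ℝ (TangentSpace 𝓘(ℝ, E) x) :=
  inferInstanceAs (FiniteDimensional ℝ E)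

instance (x : M) : CompleteSpace (TangentSpace 𝓘(ℝ, E) x) :=
  FiniteDimensional.complete ℝ _

/-- The Riemannian gradient: `⟪∇f(x), v⟫ = df_x(v)` for all `v ∈ T_x M`. -/
def riemGrad (f : M → ℝ) (x : M) : TangentSpace 𝓘(ℝ, E) x :=
  (InnerProductSpace.toDual ℝ (TangentSpace 𝓘(ℝ, E) x)).symm (mvfderiv 𝓘(ℝ, E) f x)

variable (E) in
/-- `f` is differentiable and geodesically `L`-smooth: along every geodesic `γ : [0,1] → M` from
`x = γ 0` to `y = γ 1`, so that `γ'(0)` is `Exp_x⁻¹(y)`, one has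
`‖∇f(x) - Γ_y^x ∇f(y)‖ ≤ L ‖Exp_x⁻¹(y)‖`. -/
def IsGSmooth (L : ℝ) (f : M → ℝ) : Prop :=
  MDifferentiable 𝓘(ℝ, E) 𝓘(ℝ, ℝ) f ∧
  ∀ γ : ℝ → M, IsGeodesic (E := E) γ →
    ‖riemGrad (E := E) f (γ 0) - parallelTransport γ 1 0 ⟨γ 1, riemGrad f (γ 1)⟩‖
      ≤ L * ‖velocity (E := E) γ 0‖

/-- The finite-sum objective `f = (1/n) ∑ fᵢ`. -/
def objective {n : ℕ} (f : Fin n → M → ℝ) (x : M) : ℝ := (∑ i, f i x) / n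

/-- The minibatch gradient `(1/|S|) ∑_{i ∈ S} ∇fᵢ(x)`. -/
def batchGrad {n : ℕ} (f : Fin n → M → ℝ) (S : Finset (Fin n)) (x : M) :
    TangentSpace 𝓘(ℝ, E) x :=
  (S.card : ℝ)⁻¹ • ∑ i ∈ S, riemGrad (f i) x

/-- The R-PAGE iterates `(x^k, g^k) ∈ TM` with large minibatch `B = n`, started at `x⁰`, for given
outcomes of the coin flips (`coin k` decides about `g^{k+1}`; `true` means a full gradient) and of
the small minibatches (`batch k` is used for `g^{k+1}`). The transports are along the geodesic
step from `x^k` to `x^{k+1}`. -/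
def iterate {n : ℕ} (f : Fin n → M → ℝ) (η : ℝ) (x₀ : M)
    (coin : ℕ → Bool) (batch : ℕ → Finset (Fin n)) : ℕ → TangentBundle 𝓘(ℝ, E) M
  | 0 => ⟨x₀, batchGrad f Finset.univ x₀⟩
  | k + 1 =>
    let s := iterate f η x₀ coin batch k
    let step : TangentBundle 𝓘(ℝ, E) M := ⟨s.proj, -(η • s.snd)⟩
    let y : M := riemExp step
    let transport : TangentBundle 𝓘(ℝ, E) M → TangentSpace 𝓘(ℝ, E) y :=
      parallelTransport (expCurve step) 0 1
    ⟨y, if coin k then batchGrad f Finset.univ y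
        else transport s + batchGrad f (batch k) y
          - transport ⟨s.proj, batchGrad f (batch k) s.proj⟩⟩

variable (E) in
/-- The output `x̂^K = x^j` of R-PAGE, `j` being the output index. -/
def output {n : ℕ} (f : Fin n → M → ℝ) (η : ℝ) (x₀ : M)
    (coin : ℕ → Bool) (batch : ℕ → Finset (Fin n)) {K : ℕ} (j : Fin K) : M :=
  (iterate (E := E) f η x₀ coin batch j).proj

end Geometry

section Randomness

/-- The number of evaluations of component gradients `∇fᵢ` in the initialization and the first `K`
iterations: `n` for a full gradient, `b` at each of the two points `x^{k+1}`, `x^k` otherwise. -/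
def gradCount (n b : ℕ) (coin : ℕ → Bool) (K : ℕ) : ℕ :=
  n + ∑ k ∈ Finset.range K, if coin k then n else 2 * b

/-- The randomness of R-PAGE with `K` iterations: independent coins with success probability `p`,
independent minibatches uniform among the `b`-element subsets of the `n` indices, and an
independent output index, uniform on `{0, …, K - 1}`. -/
structure IsRandomness {Ω : Type*} [MeasurableSpace Ω] (P : Measure Ω) (n b K : ℕ) (p : ℝ)
    (coin : ℕ → Ω → Bool) (batch : ℕ → Ω → Finset (Fin n)) (idx : Ω → Fin K) : Prop where
  measurable_coin : ∀ k, Measurable (coin k)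
  measurable_batch : ∀ k, Measurable (batch k)
  measurable_idx : Measurable idx
  coin_law : ∀ k, P.real {ξ | coin k ξ = true} = p
  batch_card : ∀ k, ∀ᵐ ξ ∂P, (batch k ξ).card = b
  batch_law : ∀ k, ∀ S : Finset (Fin n), S.card = b →
    P.real {ξ | batch k ξ = S} = 1 / (n.choose b : ℝ)
  idx_law : ∀ j, P.real {ξ | idx ξ = j} = 1 / (K : ℝ)
  indep_coin_batch : ∀ k, IndepFun (coin k) (batch k) P
  indep_iterations : iIndepFun (fun k ξ ↦ (coin k ξ, batch k ξ)) P
  indep_idx : IndepFun idx (fun ξ k ↦ (coin k ξ, batch k ξ)) P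

end Randomness

end RPAGE

end

/-
Parallel transport exists along every `C¹` curve: in charts it is a linear ordinary differential
equation, and the covariant derivative does not depend on the chart. It is an isometry by
compatibility with the metric. Since the velocity of a geodesic is parallel, geodesic smoothness
gives the descent inequality along geodesics, and it bounds the transported gradient differences
which enter the recursive estimator. Sampling without replacement has at most the variance of
independent sampling, so the estimation error `‖g - ∇f‖²` contracts in expectation by the factor
`1 - p`, up to a multiple of the squared step length. For the given step size these two facts make
`f - f* + η / (2p) ‖g - ∇f‖²` a Lyapunov function, which drops in expectation by at least
`η / 2 ‖∇f‖²` in each iteration. Telescoping yields `𝔼 ‖∇f(x̂)‖² ≤ 2 δ⁰ / (η K)`, and Jensen's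
inequality passes to `𝔼 ‖∇f(x̂)‖`. An iteration costs at most `3 b` gradients on average.
-/

noncomputable section

namespace RPAGE

open scoped BigOperators

set_option maxSynthPendingDepth 3

section Calculus

variable {E F : Type*} [NormedAddCommGroup E] [NormedSpace ℝ E]
  [NormedAddCommGroup F] [NormedSpace ℝ F]

lemma fderiv_bilin_apply {G : E → F →L[ℝ] F →L[ℝ] ℝ} {y : E} (hG : DifferentiableAt ℝ G y)
    (a : E) (u w : F) : fderiv ℝ G y a u w = fderiv ℝ (fun z ↦ G z u w) y a := by
  have h := (hG.hasFDerivAt.clm_apply (hasFDerivAt_const u y)).clm_apply (hasFDerivAt_const w y)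
  simp [h.fderiv]

lemma fderiv_bilin_symm {G : E → F →L[ℝ] F →L[ℝ] ℝ} {y : E} (hG : DifferentiableAt ℝ G y)
    (hsymm : ∀ z u w, G z u w = G z w u) (a : E) (u w : F) :
    fderiv ℝ G y a u w = fderiv ℝ G y a w u := by
  simp only [fderiv_bilin_apply hG, hsymm _ u w]

/-- The Christoffel symbols of the first kind
`Γ(a, u, w) = ½ (B(a, u, w) + B(u, a, w) - B(w, a, u))` of the derivative `B` of a metric tensor,
as a bilinear form in `u` and `w`. -/
def christoffelForm (B : E →L[ℝ] E →L[ℝ] E →L[ℝ] ℝ) (a : E) : E →L[ℝ] E →L[ℝ] ℝ :=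
  (1 / 2 : ℝ) • (B a + B.flip a - (B.flip a).flip)

lemma christoffelForm_apply (B : E →L[ℝ] E →L[ℝ] E →L[ℝ] ℝ) (a u w : E) :
    christoffelForm B a u w = (B a u w + B u a w - B w a u) / 2 := by
  simp only [christoffelForm, one_div, _root_.smul_apply, _root_.sub_apply, _root_.add_apply,
    ContinuousLinearMap.flip_apply, smul_eq_mul]
  ring

/-- The covariant derivative `g(u', ·) + Γ(a, u, ·)`, with lowered index, of a vector field along a
curve for the metric tensor `G`: the curve has position `y` and velocity `a`, the field has value
`u` and componentwise derivative `u'`. -/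
def covDerivForm (G : E → E →L[ℝ] E →L[ℝ] ℝ) (y a u u' : E) : E →L[ℝ] ℝ :=
  G y u' + christoffelForm (fderiv ℝ G y) a u

lemma covDerivForm_add (G : E → E →L[ℝ] E →L[ℝ] ℝ) (y a u u' v v' : E) :
    covDerivForm G y a (u + v) (u' + v') = covDerivForm G y a u u' + covDerivForm G y a v v' := by
  simp only [covDerivForm, map_add]
  abel

lemma covDerivForm_smul (G : E → E →L[ℝ] E →L[ℝ] ℝ) (y a : E) (c : ℝ) (u u' : E) :
    covDerivForm G y a (c • u) (c • u') = c • covDerivForm G y a u u' := by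
  simp only [covDerivForm, map_smul, smul_add]

lemma covDerivForm_smul_velocity (G : E → E →L[ℝ] E →L[ℝ] ℝ) (y a : E) (c : ℝ) (u u' : E) :
    covDerivForm G y (c • a) u (c • u') = c • covDerivForm G y a u u' := by
  ext w
  simp only [covDerivForm, map_smul, _root_.add_apply, _root_.smul_apply, christoffelForm_apply,
    smul_eq_mul]
  ring

lemma hasDerivWithinAt_bilin_comp {G : E → E →L[ℝ] E →L[ℝ] ℝ} {c U W : ℝ → E}
    {c' U' W' : E} {S : Set ℝ} {t : ℝ} (hG : DifferentiableAt ℝ G (c t))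
    (hsymm : ∀ y u w, G y u w = G y w u) (hc : HasDerivWithinAt c c' S t)
    (hU : HasDerivWithinAt U U' S t) (hW : HasDerivWithinAt W W' S t) :
    HasDerivWithinAt (fun s ↦ G (c s) (U s) (W s))
      (covDerivForm G (c t) c' (U t) U' (W t) + covDerivForm G (c t) c' (W t) W' (U t)) S t := by
  have hGc : HasDerivWithinAt (fun s ↦ G (c s)) (fderiv ℝ G (c t) c') S t :=
    hG.hasFDerivAt.comp_hasDerivWithinAt t hc
  refine ((hGc.clm_apply hU).clm_apply hW).congr_deriv ?_
  simp only [covDerivForm, _root_.add_apply, christoffelForm_apply]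
  rw [fderiv_bilin_symm hG hsymm c' (W t), hsymm _ W']
  ring

lemma fderiv_bilin_pullback {G₀ : E → E →L[ℝ] E →L[ℝ] ℝ} {G₁ : F → F →L[ℝ] F →L[ℝ] ℝ}
    {τ : E → F} {y : E} (hτ : ContDiffAt ℝ 2 τ y) (hG₀ : DifferentiableAt ℝ G₀ y)
    (hG₁ : DifferentiableAt ℝ G₁ (τ y))
    (hG : ∀ᶠ z in nhds y, ∀ u w, G₀ z u w = G₁ (τ z) (fderiv ℝ τ z u) (fderiv ℝ τ z w))
    (a u w : E) :
    fderiv ℝ G₀ y a u w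
      = fderiv ℝ G₁ (τ y) (fderiv ℝ τ y a) (fderiv ℝ τ y u) (fderiv ℝ τ y w)
        + G₁ (τ y) (fderiv ℝ (fderiv ℝ τ) y a u) (fderiv ℝ τ y w)
        + G₁ (τ y) (fderiv ℝ τ y u) (fderiv ℝ (fderiv ℝ τ) y a w) := by
  have hτ₁ : HasFDerivAt τ (fderiv ℝ τ y) y := (hτ.differentiableAt two_ne_zero).hasFDerivAt
  have hτ₂ : HasFDerivAt (fderiv ℝ τ) (fderiv ℝ (fderiv ℝ τ) y) y :=
    ((hτ.fderiv_right (m := 1) (by norm_num)).differentiableAt one_ne_zero).hasFDerivAt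
  have hG₁τ : HasFDerivAt (fun z ↦ G₁ (τ z)) (fderiv ℝ G₁ (τ y) ∘L fderiv ℝ τ y) y :=
    hG₁.hasFDerivAt.comp y hτ₁
  have h := (hG₁τ.clm_apply (hτ₂.clm_apply (hasFDerivAt_const u y))).clm_apply
    (hτ₂.clm_apply (hasFDerivAt_const w y))
  rw [fderiv_bilin_apply hG₀,
    (h.congr_of_eventuallyEq (hG.mono fun z hz ↦ hz u w)).fderiv]
  simp only [_root_.add_apply, ContinuousLinearMap.comp_apply, ContinuousLinearMap.flip_apply,
    _root_.zero_apply, map_zero, zero_add]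
  ring

/-- The second derivatives of `τ` in `fderiv_bilin_pullback` are symmetric, so in the alternating
sum defining the Christoffel symbols only `G₁(τ'' a u, τ' w)` survives: this is the correction
term of the componentwise derivative of `τ' U`. -/
lemma covDerivForm_pullback {G₀ : E → E →L[ℝ] E →L[ℝ] ℝ} {G₁ : F → F →L[ℝ] F →L[ℝ] ℝ}
    {τ : E → F} {y : E} (hτ : ContDiffAt ℝ 2 τ y) (hG₀ : DifferentiableAt ℝ G₀ y)
    (hG₁ : DifferentiableAt ℝ G₁ (τ y)) (hsymm : ∀ z u w, G₁ z u w = G₁ z w u)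
    (hG : ∀ᶠ z in nhds y, ∀ u w, G₀ z u w = G₁ (τ z) (fderiv ℝ τ z u) (fderiv ℝ τ z w))
    (a u u' w : E) :
    covDerivForm G₀ y a u u' w
      = covDerivForm G₁ (τ y) (fderiv ℝ τ y a) (fderiv ℝ τ y u)
          (fderiv ℝ (fderiv ℝ τ) y a u + fderiv ℝ τ y u') (fderiv ℝ τ y w) := by
  have hs : IsSymmSndFDerivAt ℝ τ y :=
    hτ.isSymmSndFDerivAt (by rw [minSmoothness_of_isRCLikeNormedField])
  simp only [covDerivForm, _root_.add_apply, christoffelForm_apply, map_add,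
    fderiv_bilin_pullback hτ hG₀ hG₁ hG, hG.self_of_nhds u' w]
  rw [hs.eq u a, hs.eq w a, hs.eq w u, hsymm _ (fderiv ℝ τ y a),
    hsymm _ (fderiv ℝ (fderiv ℝ τ) y a w)]
  ring

lemma continuous_christoffelForm : Continuous
    fun q : (E →L[ℝ] E →L[ℝ] E →L[ℝ] ℝ) × E ↦ christoffelForm q.1 q.2 := by
  have hflip : Continuous fun q : (E →L[ℝ] E →L[ℝ] E →L[ℝ] ℝ) × E ↦ q.1.flip q.2 :=
    ((ContinuousLinearMap.flipₗᵢ ℝ E E (E →L[ℝ] ℝ)).continuous.comp continuous_fst).clm_apply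
      continuous_snd
  exact (((continuous_fst.clm_apply continuous_snd).add hflip).sub
    ((ContinuousLinearMap.flipₗᵢ ℝ E E ℝ).continuous.comp hflip)).const_smul (1 / 2 : ℝ)

/-- The operator `A` for which the parallel transport equation along a curve with position `y` and
velocity `a` is `u' = A u`. -/
def transportOperator (G : E → E →L[ℝ] E →L[ℝ] ℝ) (y a : E) : E →L[ℝ] E :=
  -((G y).inverse ∘L christoffelForm (fderiv ℝ G y) a)

lemma covDerivForm_transportOperator {G : E → E →L[ℝ] E →L[ℝ] ℝ} {y : E}
    (hG : (G y).IsInvertible) (a u : E) :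
    covDerivForm G y a u (transportOperator G y a u) = 0 := by
  simp only [covDerivForm, transportOperator, _root_.neg_apply, ContinuousLinearMap.comp_apply,
    map_neg, hG.self_apply_inverse, neg_add_cancel]

lemma continuousAt_transportOperator [CompleteSpace E] {G : E → E →L[ℝ] E →L[ℝ] ℝ}
    {X : Type*} [TopologicalSpace X] {c a : X → E} {t : X} (hG : ContDiffAt ℝ 1 G (c t))
    (hinv : (G (c t)).IsInvertible) (hc : ContinuousAt c t) (ha : ContinuousAt a t) :
    ContinuousAt (fun s ↦ transportOperator G (c s) (a s)) t := by
  have hGc : ContinuousAt (fun s ↦ G (c s)) t := hG.continuousAt.comp hc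
  have hG' : ContinuousAt (fun s ↦ fderiv ℝ G (c s)) t :=
    (hG.fderiv_right (m := 0) (by norm_num)).continuousAt.comp hc
  have hinverse : ContinuousAt (fun s ↦ (G (c s)).inverse) t :=
    (hinv.contDiffAt_map_inverse (n := 0)).continuousAt.comp (f := fun s ↦ G (c s)) hGc
  exact (hinverse.clm_comp
    (continuous_christoffelForm.continuousAt.comp (hG'.prodMk ha))).neg

lemma exists_linear_ode_solution [CompleteSpace E] {A : ℝ → E →L[ℝ] E} {a b s : ℝ}
    {C : NNReal} (hA : ContinuousOn A (Set.Icc a b)) (hAC : ∀ t ∈ Set.Icc a b, ‖A t‖ ≤ C)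
    (hab : 2 * C * (b - a) ≤ 1) (hs : s ∈ Set.Icc a b) (u : E) :
    ∃ U : ℝ → E, U s = u ∧
      ∀ t ∈ Set.Icc a b, HasDerivWithinAt U (A t (U t)) (Set.Icc a b) t := by
  have hP : IsPicardLindelof (fun t x ↦ A t x) (⟨s, hs⟩ : Set.Icc a b) u ‖u‖₊ 0
      (C * (2 * ‖u‖₊)) C := by
    refine ⟨fun t ht ↦ ?_, fun x _ ↦ hA.clm_apply continuousOn_const, fun t ht x hx ↦ ?_, ?_⟩
    · exact ((A t).lipschitz.weaken (by exact_mod_cast hAC t ht)).lipschitzOnWith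
    · have hxu : ‖x - u‖ ≤ ‖u‖ := by simpa [dist_eq_norm] using hx
      have hx2 : ‖x‖ ≤ 2 * ‖u‖ := by linarith [norm_le_norm_sub_add x u]
      refine ((A t).le_of_opNorm_le (hAC t ht) x).trans ?_
      push_cast
      gcongr
    · have hmax : max (b - s) (s - a) ≤ b - a := max_le (by linarith [hs.1]) (by linarith [hs.2])
      push_cast
      calc C * (2 * ‖u‖) * max (b - s) (s - a)
          ≤ C * (2 * ‖u‖) * (b - a) := by gcongr
        _ = 2 * C * (b - a) * ‖u‖ := by ring
        _ ≤ ‖u‖ - 0 := by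
          rw [sub_zero]
          exact mul_le_of_le_one_left (norm_nonneg u) hab
  exact hP.exists_eq_forall_mem_Icc_hasDerivWithinAt₀

lemma eventually_exists_linear_ode_solution [CompleteSpace E] {A : ℝ → E →L[ℝ] E} {t₀ : ℝ}
    (hA : ∀ᶠ t in nhds t₀, ContinuousAt A t) :
    ∀ᶠ δ in nhds (0 : ℝ), ∀ s ∈ Metric.closedBall t₀ δ, ∀ u : E, ∃ U : ℝ → E, U s = u ∧
      ∀ t ∈ Metric.closedBall t₀ δ,
        HasDerivWithinAt U (A t (U t)) (Metric.closedBall t₀ δ) t := by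
  set C := ‖A t₀‖₊ + 1
  have hbound : ∀ᶠ t in nhds t₀, ‖A t‖ ≤ C := by
    filter_upwards [hA.self_of_nhds.norm.eventually_lt_const (lt_add_one ‖A t₀‖)] with t ht
    exact ht.le
  have hC : 0 < (C : ℝ) := by positivity
  filter_upwards [eventually_closedBall_subset (hA.and hbound),
    eventually_le_nhds (one_div_pos.2 (mul_pos four_pos hC))] with δ hsub hδ s hs u
  rw [Real.closedBall_eq_Icc] at hs hsub ⊢
  exact exists_linear_ode_solution (C := C)
    (fun t ht ↦ (hsub ht).1.continuousWithinAt) (fun t ht ↦ (hsub ht).2)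
    (by rw [le_div_iff₀ (by positivity)] at hδ; linarith) hs u

end Calculus

section Charts

variable {E : Type*} [NormedAddCommGroup E]
  {M : Type*} [TopologicalSpace M] [ChartedSpace E M]

lemma eventually_mem_chart_source {γ : ℝ → M} {t : ℝ} {x₀ : M} (hγ : ContinuousAt γ t)
    (h₀ : γ t ∈ (chartAt E x₀).source) : ∀ᶠ s in nhds t, γ s ∈ (chartAt E x₀).source :=
  hγ.eventually_mem ((chartAt E x₀).open_source.mem_nhds h₀)

variable [NormedSpace ℝ E]

lemma extChartAt_symm_extChartAt {x₀ p : M} (hp : p ∈ (chartAt E x₀).source) :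
    (extChartAt 𝓘(ℝ, E) x₀).symm (extChartAt 𝓘(ℝ, E) x₀ p) = p :=
  (extChartAt 𝓘(ℝ, E) x₀).left_inv ((extChartAt_source 𝓘(ℝ, E) x₀).symm ▸ hp)

lemma extChartAt_target_mem_nhds_of_mem_source {x₀ p : M} (hp : p ∈ (chartAt E x₀).source) :
    (extChartAt 𝓘(ℝ, E) x₀).target ∈ nhds (extChartAt 𝓘(ℝ, E) x₀ p) :=
  (isOpen_extChartAt_target x₀).mem_nhds
    ((extChartAt 𝓘(ℝ, E) x₀).map_source (by rwa [extChartAt_source]))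

/-- The transition map from the chart at `x₀` to the chart at `x₁`. -/
def transition (x₀ x₁ : M) (y : E) : E :=
  extChartAt 𝓘(ℝ, E) x₁ ((extChartAt 𝓘(ℝ, E) x₀).symm y)

lemma transition_extChartAt {x₀ p : M} (x₁ : M) (hp : p ∈ (chartAt E x₀).source) :
    transition x₀ x₁ (extChartAt 𝓘(ℝ, E) x₀ p) = extChartAt 𝓘(ℝ, E) x₁ p := by
  rw [transition, extChartAt_symm_extChartAt hp]

lemma velocity_comp_mul {γ : ℝ → M} {c t : ℝ}
    (hγ : MDifferentiableAt 𝓘(ℝ, ℝ) 𝓘(ℝ, E) γ (c * t)) :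
    velocity (E := E) (fun r ↦ γ (c * r)) t = c • velocity (E := E) γ (c * t) := by
  have hmul : HasMFDerivAt 𝓘(ℝ, ℝ) 𝓘(ℝ, ℝ) (fun r : ℝ ↦ c * r) t
      (c • ContinuousLinearMap.id ℝ ℝ : ℝ →L[ℝ] ℝ) :=
    ((hasFDerivAt_id t).const_mul c).hasMFDerivAt
  have hcomp := (hγ.hasMFDerivAt.comp t hmul).mfderiv
  let D : ℝ →L[ℝ] E := mfderiv 𝓘(ℝ, ℝ) 𝓘(ℝ, E) γ (c * t)
  exact (congrArg (fun A : ℝ →L[ℝ] E ↦ A 1) hcomp).trans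
    (by simp : (D.comp (c • ContinuousLinearMap.id ℝ ℝ)) 1 = c • D 1)

variable [IsManifold 𝓘(ℝ, E) ∞ M]

lemma coords_ofCoords {x₀ p : M} (hp : p ∈ (chartAt E x₀).source) (u : E) :
    coords x₀ p (ofCoords x₀ p u) = u :=
  (trivializationAt E (TangentSpace 𝓘(ℝ, E)) x₀).continuousLinearMapAt_symmL hp u

lemma ofCoords_coords {x₀ p : M} (hp : p ∈ (chartAt E x₀).source)
    (v : TangentSpace 𝓘(ℝ, E) p) : ofCoords x₀ p (coords x₀ p v) = v :=
  (trivializationAt E (TangentSpace 𝓘(ℝ, E)) x₀).symmL_continuousLinearMapAt hp v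

lemma coords_add (x₀ p : M) (v w : TangentSpace 𝓘(ℝ, E) p) :
    coords x₀ p (v + w) = coords x₀ p v + coords x₀ p w := map_add _ _ _

lemma coords_smul (x₀ p : M) (c : ℝ) (v : TangentSpace 𝓘(ℝ, E) p) :
    coords x₀ p (c • v) = c • coords x₀ p v := map_smul _ _ _

lemma contDiffAt_transition {x₀ x₁ p : M} (h₀ : p ∈ (chartAt E x₀).source)
    (h₁ : p ∈ (chartAt E x₁).source) :
    ContDiffAt ℝ ∞ (transition x₀ x₁) (extChartAt 𝓘(ℝ, E) x₀ p) := by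
  have h := contDiffWithinAt_ext_coord_change (n := ∞) (I := 𝓘(ℝ, E)) x₁ x₀
    (y := extChartAt 𝓘(ℝ, E) x₀ p) (by
      simpa only [PartialEquiv.trans_source, PartialEquiv.symm_source, Set.mem_inter_iff,
        Set.mem_preimage, extChartAt_symm_extChartAt h₀, extChartAt_source] using
        ⟨mem_of_mem_nhds (extChartAt_target_mem_nhds_of_mem_source h₀), h₁⟩)
  rwa [modelWithCornersSelf_coe, Set.range_id, contDiffWithinAt_univ] at h

lemma coords_eq_tangentCoordChange {x₀ p : M} (h₀ : p ∈ (chartAt E x₀).source)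
    (v : TangentSpace 𝓘(ℝ, E) p) : coords x₀ p v = tangentCoordChange 𝓘(ℝ, E) p x₀ p v := by
  rw [coords, TangentBundle.continuousLinearMapAt_trivializationAt_eq_core h₀]
  rfl

lemma coords_eq_fderiv_transition {x₀ x₁ p : M} (h₀ : p ∈ (chartAt E x₀).source)
    (h₁ : p ∈ (chartAt E x₁).source) (v : TangentSpace 𝓘(ℝ, E) p) :
    coords x₁ p v
      = fderiv ℝ (transition x₀ x₁) (extChartAt 𝓘(ℝ, E) x₀ p) (coords x₀ p v) := by
  rw [coords_eq_tangentCoordChange h₀, coords_eq_tangentCoordChange h₁,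
    ← tangentCoordChange_comp (I := 𝓘(ℝ, E)) (w := p) (x := x₀) (y := x₁) (z := p) (v := v)
      ⟨⟨mem_extChartAt_source p, by rwa [extChartAt_source]⟩, by rwa [extChartAt_source]⟩,
    tangentCoordChange_def (x := x₀)]
  simp only [modelWithCornersSelf_coe, Set.range_id, fderivWithin_univ]
  rfl

lemma coords_velocity {γ : ℝ → M} {x₀ : M} {t : ℝ}
    (hγ : MDifferentiableAt 𝓘(ℝ, ℝ) 𝓘(ℝ, E) γ t) (h₀ : γ t ∈ (chartAt E x₀).source) :
    HasDerivAt (fun s ↦ extChartAt 𝓘(ℝ, E) x₀ (γ s)) (coords x₀ (γ t) (velocity γ t)) t := by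
  have hchart : MDifferentiableAt 𝓘(ℝ, E) 𝓘(ℝ, E) (extChartAt 𝓘(ℝ, E) x₀) (γ t) :=
    mdifferentiableAt_extChartAt h₀
  unfold coords velocity
  rw [TangentBundle.continuousLinearMapAt_trivializationAt h₀]
  let D : ℝ →L[ℝ] E := (mfderiv 𝓘(ℝ, E) 𝓘(ℝ, E) (extChartAt 𝓘(ℝ, E) x₀) (γ t)).comp
    (mfderiv 𝓘(ℝ, ℝ) 𝓘(ℝ, E) γ t)
  have hD : HasFDerivAt (fun s ↦ extChartAt 𝓘(ℝ, E) x₀ (γ s)) D t :=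
    (hchart.hasMFDerivAt.comp t hγ.hasMFDerivAt).hasFDerivAt
  exact hD.hasDerivAt

lemma continuousAt_coords_velocity {γ : ℝ → M} {x₀ : M} {t : ℝ}
    (hγ : ContMDiff 𝓘(ℝ, ℝ) 𝓘(ℝ, E) 1 γ) (ht : γ t ∈ (chartAt E x₀).source) :
    ContinuousAt (fun s ↦ coords (E := E) x₀ (γ s) (velocity γ s)) t := by
  have hc : ContDiffAt ℝ 1 (fun s ↦ extChartAt 𝓘(ℝ, E) x₀ (γ s)) t :=
    ((contMDiffAt_extChartAt' ht).comp t hγ.contMDiffAt).contDiffAt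
  have hderiv : ContinuousAt (deriv fun s ↦ extChartAt 𝓘(ℝ, E) x₀ (γ s)) t :=
    (hc.fderiv_right (m := 0) (by norm_num)).continuousAt.clm_apply continuousAt_const
  refine hderiv.congr ?_
  filter_upwards [eventually_mem_chart_source hγ.continuous.continuousAt ht] with s hs
  exact (coords_velocity (hγ.mdifferentiable one_ne_zero s) hs).deriv

lemma contMDiffOn_ofCoords (x₀ : M) (u : E) :
    ContMDiffOn 𝓘(ℝ, E) (𝓘(ℝ, E).prod 𝓘(ℝ, E)) ∞
      (fun p ↦ (⟨p, ofCoords x₀ p u⟩ : TangentBundle 𝓘(ℝ, E) M)) (chartAt E x₀).source := by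
  rw [Trivialization.contMDiffOn_section_iff (trivializationAt E (TangentSpace 𝓘(ℝ, E)) x₀)
    (chartAt E x₀).open_source subset_rfl]
  refine (contMDiffOn_const (c := u)).congr fun p hp ↦ ?_
  have hp' : p ∈ (trivializationAt E (TangentSpace 𝓘(ℝ, E)) x₀).baseSet := hp
  have h := coords_ofCoords hp u
  rwa [coords, Trivialization.continuousLinearMapAt_apply, Trivialization.linearMapAt_apply,
    if_pos hp'] at h

end Charts

section Metric

variable {E : Type*} [NormedAddCommGroup E] [NormedSpace ℝ E]
  {M : Type*} [TopologicalSpace M] [ChartedSpace E M] [IsManifold 𝓘(ℝ, E) ∞ M]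
  [RiemannianBundle (fun x : M ↦ TangentSpace 𝓘(ℝ, E) x)]

/-- The metric tensor in the chart at `x₀`, as a continuous bilinear form. -/
def metricForm (x₀ : M) (y : E) : E →L[ℝ] E →L[ℝ] ℝ :=
  (innerSL ℝ (E := TangentSpace 𝓘(ℝ, E) ((extChartAt 𝓘(ℝ, E) x₀).symm y))).bilinearComp
    ((trivializationAt E (TangentSpace 𝓘(ℝ, E)) x₀).symmL ℝ ((extChartAt 𝓘(ℝ, E) x₀).symm y))
    ((trivializationAt E (TangentSpace 𝓘(ℝ, E)) x₀).symmL ℝ ((extChartAt 𝓘(ℝ, E) x₀).symm y))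

lemma metricForm_apply (x₀ : M) (y u w : E) :
    metricForm x₀ y u w = metricInChart x₀ y u w := rfl

lemma metricForm_symm (x₀ : M) (y u w : E) : metricForm x₀ y u w = metricForm x₀ y w u :=
  real_inner_comm (ofCoords x₀ _ w) (ofCoords x₀ _ u)

lemma inner_eq_metricForm {x₀ p : M} (hp : p ∈ (chartAt E x₀).source)
    (v w : TangentSpace 𝓘(ℝ, E) p) :
    inner ℝ v w = metricForm x₀ (extChartAt 𝓘(ℝ, E) x₀ p) (coords x₀ p v) (coords x₀ p w) := by
  rw [metricForm_apply, metricInChart, extChartAt_symm_extChartAt hp, ofCoords_coords hp,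
    ofCoords_coords hp]

lemma injective_metricForm {x₀ p : M} (hp : p ∈ (chartAt E x₀).source) :
    Function.Injective (metricForm x₀ (extChartAt 𝓘(ℝ, E) x₀ p)) := by
  rw [injective_iff_map_eq_zero]
  intro u hu
  have h : inner ℝ (ofCoords x₀ p u) (ofCoords x₀ p u) = 0 := by
    rw [inner_eq_metricForm hp, coords_ofCoords hp, hu, _root_.zero_apply]
  rw [← coords_ofCoords hp u, inner_self_eq_zero.1 h]
  exact map_zero _

lemma metricForm_eventuallyEq_pullback {x₀ x₁ p : M} (h₀ : p ∈ (chartAt E x₀).source)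
    (h₁ : p ∈ (chartAt E x₁).source) :
    ∀ᶠ z in nhds (extChartAt 𝓘(ℝ, E) x₀ p), ∀ u w,
      metricForm x₀ z u w = metricForm x₁ (transition x₀ x₁ z)
        (fderiv ℝ (transition x₀ x₁) z u) (fderiv ℝ (transition x₀ x₁) z w) := by
  have hsymm := continuousAt_extChartAt_symm'' (I := 𝓘(ℝ, E))
    (mem_of_mem_nhds (extChartAt_target_mem_nhds_of_mem_source h₀))
  filter_upwards [extChartAt_target_mem_nhds_of_mem_source h₀, hsymm.eventually_mem
    ((chartAt E x₁).open_source.mem_nhds ((extChartAt_symm_extChartAt h₀).symm ▸ h₁))]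
    with z hz₀ hz₁ u w
  obtain ⟨q, hq₀, rfl⟩ : ∃ q ∈ (chartAt E x₀).source, extChartAt 𝓘(ℝ, E) x₀ q = z :=
    ⟨(extChartAt 𝓘(ℝ, E) x₀).symm z, by
      simpa only [extChartAt_source] using (extChartAt 𝓘(ℝ, E) x₀).map_target hz₀,
      (extChartAt 𝓘(ℝ, E) x₀).right_inv hz₀⟩
  rw [extChartAt_symm_extChartAt hq₀] at hz₁
  rw [← coords_ofCoords hq₀ u, ← coords_ofCoords hq₀ w, transition_extChartAt x₁ hq₀,
    ← coords_eq_fderiv_transition hq₀ hz₁, ← coords_eq_fderiv_transition hq₀ hz₁,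
    ← inner_eq_metricForm hz₁, ← inner_eq_metricForm hq₀]

lemma isInvertible_metricForm [FiniteDimensional ℝ E] {x₀ p : M}
    (hp : p ∈ (chartAt E x₀).source) :
    (metricForm x₀ (extChartAt 𝓘(ℝ, E) x₀ p)).IsInvertible := by
  have hfin : Module.finrank ℝ E = Module.finrank ℝ (E →L[ℝ] ℝ) := by
    rw [← (LinearMap.toContinuousLinearMap (𝕜 := ℝ) (E := E) (F' := ℝ)).finrank_eq]
    exact Subspace.dual_finrank_eq.symm
  exact ⟨(LinearEquiv.ofInjectiveOfFinrankEq (metricForm x₀ (extChartAt 𝓘(ℝ, E) x₀ p) :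
    E →ₗ[ℝ] E →L[ℝ] ℝ) (injective_metricForm hp) hfin).toContinuousLinearEquiv, rfl⟩

variable [IsContMDiffRiemannianBundle 𝓘(ℝ, E) 1 E (fun x : M ↦ TangentSpace 𝓘(ℝ, E) x)]

lemma contDiffOn_metricInChart (x₀ : M) (u w : E) :
    ContDiffOn ℝ 1 (fun y ↦ metricInChart x₀ y u w) (extChartAt 𝓘(ℝ, E) x₀).target := by
  have h : ∀ u : E, ContMDiffOn 𝓘(ℝ, E) (𝓘(ℝ, E).prod 𝓘(ℝ, E)) 1
      (fun y ↦ (⟨(extChartAt 𝓘(ℝ, E) x₀).symm y, ofCoords x₀ ((extChartAt 𝓘(ℝ, E) x₀).symm y) u⟩ :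
        TangentBundle 𝓘(ℝ, E) M)) (extChartAt 𝓘(ℝ, E) x₀).target := fun u ↦
    ((contMDiffOn_ofCoords x₀ u).comp (contMDiffOn_extChartAt_symm x₀) fun y hy ↦ by
      simpa only [Set.mem_preimage, extChartAt_source]
        using (extChartAt 𝓘(ℝ, E) x₀).map_target hy).of_le (by simp)
  exact contMDiffOn_iff_contDiffOn.1 <|
    ContMDiffOn.inner_bundle (E := fun x : M ↦ TangentSpace 𝓘(ℝ, E) x)
      (IB := 𝓘(ℝ, E)) (b := fun y ↦ (extChartAt 𝓘(ℝ, E) x₀).symm y) (h u) (h w)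

variable [FiniteDimensional ℝ E]

lemma contDiffAt_metricForm {x₀ p : M} (hp : p ∈ (chartAt E x₀).source) :
    ContDiffAt ℝ 1 (fun y : E ↦ metricForm x₀ y) (extChartAt 𝓘(ℝ, E) x₀ p) :=
  ContDiffOn.contDiffAt (contDiffOn_clm_apply.2 fun u ↦ contDiffOn_clm_apply.2 fun w ↦
    contDiffOn_metricInChart x₀ u w) (extChartAt_target_mem_nhds_of_mem_source hp)

lemma differentiableAt_metricForm {x₀ p : M} (hp : p ∈ (chartAt E x₀).source) :
    DifferentiableAt ℝ (fun y : E ↦ metricForm x₀ y) (extChartAt 𝓘(ℝ, E) x₀ p) :=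
  (contDiffAt_metricForm hp).differentiableAt one_ne_zero

lemma christoffelFirst_eq_christoffelForm (x₀ : M) (u v w : E) :
    christoffelFirst x₀ u v w
      = christoffelForm (fderiv ℝ (metricForm x₀) (extChartAt 𝓘(ℝ, E) x₀ x₀)) u v w := by
  have h := differentiableAt_metricForm (mem_chart_source E x₀)
  rw [christoffelFirst, christoffelForm_apply, fderiv_bilin_apply h, fderiv_bilin_apply h,
    fderiv_bilin_apply h]
  rfl

lemma covDerivForm_metricForm_transition {x₀ x₁ p : M} (h₀ : p ∈ (chartAt E x₀).source)
    (h₁ : p ∈ (chartAt E x₁).source) (a u u' w : E) :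
    covDerivForm (metricForm x₀) (extChartAt 𝓘(ℝ, E) x₀ p) a u u' w
      = covDerivForm (metricForm x₁) (extChartAt 𝓘(ℝ, E) x₁ p)
          (fderiv ℝ (transition x₀ x₁) (extChartAt 𝓘(ℝ, E) x₀ p) a)
          (fderiv ℝ (transition x₀ x₁) (extChartAt 𝓘(ℝ, E) x₀ p) u)
          (fderiv ℝ (fderiv ℝ (transition x₀ x₁)) (extChartAt 𝓘(ℝ, E) x₀ p) a u
            + fderiv ℝ (transition x₀ x₁) (extChartAt 𝓘(ℝ, E) x₀ p) u')
          (fderiv ℝ (transition x₀ x₁) (extChartAt 𝓘(ℝ, E) x₀ p) w) := by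
  rw [covDerivForm_pullback ((contDiffAt_transition h₀ h₁).of_le (by norm_cast))
    (differentiableAt_metricForm h₀)
    (by rw [transition_extChartAt x₁ h₀]; exact differentiableAt_metricForm h₁)
    (metricForm_symm x₁) (metricForm_eventuallyEq_pullback h₀ h₁), transition_extChartAt x₁ h₀]

end Metric

section Parallel

variable {E : Type*} [NormedAddCommGroup E] [NormedSpace ℝ E]
  {M : Type*} [TopologicalSpace M] [ChartedSpace E M] [IsManifold 𝓘(ℝ, E) ∞ M]
  [RiemannianBundle (fun x : M ↦ TangentSpace 𝓘(ℝ, E) x)]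

/-- The vector field `V` along `γ`, defined for times in `S`, has vanishing covariant derivative
at time `t`, as computed in the chart at `x₀`. In contrast to `IsParallelOn`, the base point `x₀`
of the chart is arbitrary. -/
def IsParallelWithinAt (x₀ : M) (γ : ℝ → M) (V : ∀ t, TangentSpace 𝓘(ℝ, E) (γ t)) (S : Set ℝ)
    (t : ℝ) : Prop :=
  ∃ v' : E, HasDerivWithinAt (fun s ↦ coords x₀ (γ s) (V s)) v' S t ∧
    covDerivForm (metricForm x₀) (extChartAt 𝓘(ℝ, E) x₀ (γ t))
      (coords x₀ (γ t) (velocity γ t)) (coords x₀ (γ t) (V t)) v' = 0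

variable {γ : ℝ → M} {V W : ∀ t, TangentSpace 𝓘(ℝ, E) (γ t)} {S T : Set ℝ} {s t : ℝ}

lemma IsParallelOn.mono (hV : IsParallelOn γ V S) (h : T ⊆ S) : IsParallelOn γ V T := by
  intro t ht
  obtain ⟨v', hv', hv⟩ := hV t (h ht)
  exact ⟨v', hv'.mono h, hv⟩

lemma IsParallelOn.congr (hV : IsParallelOn γ V S) (h : ∀ t ∈ S, W t = V t) :
    IsParallelOn γ W S := by
  intro t ht
  obtain ⟨v', hv', hv⟩ := hV t ht
  exact ⟨v', hv'.congr (fun s hs ↦ by rw [h s hs]) (by rw [h t ht]), by rwa [h t ht]⟩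

variable [FiniteDimensional ℝ E]
  [IsContMDiffRiemannianBundle 𝓘(ℝ, E) 1 E (fun x : M ↦ TangentSpace 𝓘(ℝ, E) x)]

lemma isParallelOn_iff_forall_isParallelWithinAt :
    IsParallelOn γ V S ↔ ∀ t ∈ S, IsParallelWithinAt (γ t) γ V S t := by
  simp only [IsParallelOn, IsParallelWithinAt, covDerivForm, ContinuousLinearMap.ext_iff,
    _root_.add_apply, christoffelFirst_eq_christoffelForm, metricForm_apply, _root_.zero_apply]

lemma IsParallelWithinAt.of_chart {x₀ x₁ : M} (hγ : MDifferentiableAt 𝓘(ℝ, ℝ) 𝓘(ℝ, E) γ t)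
    (h₀ : γ t ∈ (chartAt E x₀).source) (h₁ : γ t ∈ (chartAt E x₁).source)
    (hV : IsParallelWithinAt x₀ γ V S t) : IsParallelWithinAt x₁ γ V S t := by
  obtain ⟨v', hv', hv⟩ := hV
  have hτ : HasFDerivAt (fderiv ℝ (transition x₀ x₁))
      (fderiv ℝ (fderiv ℝ (transition x₀ x₁)) (extChartAt 𝓘(ℝ, E) x₀ (γ t)))
      (extChartAt 𝓘(ℝ, E) x₀ (γ t)) :=
    (((contDiffAt_transition h₀ h₁).fderiv_right (m := 1)
      (by norm_cast)).differentiableAt one_ne_zero).hasFDerivAt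
  have hτγ : HasDerivWithinAt
      (fun s ↦ fderiv ℝ (transition x₀ x₁) (extChartAt 𝓘(ℝ, E) x₀ (γ s)))
      (fderiv ℝ (fderiv ℝ (transition x₀ x₁)) (extChartAt 𝓘(ℝ, E) x₀ (γ t))
        (coords x₀ (γ t) (velocity γ t))) S t :=
    hτ.comp_hasDerivWithinAt t (coords_velocity hγ h₀).hasDerivWithinAt
  have hcoords : ∀ᶠ s in nhds t, coords x₁ (γ s) (V s)
      = fderiv ℝ (transition x₀ x₁) (extChartAt 𝓘(ℝ, E) x₀ (γ s)) (coords x₀ (γ s) (V s)) := by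
    filter_upwards [eventually_mem_chart_source hγ.continuousAt h₀,
      eventually_mem_chart_source hγ.continuousAt h₁] with s hs₀ hs₁
    exact coords_eq_fderiv_transition hs₀ hs₁ (V s)
  refine ⟨_, (hτγ.clm_apply hv').congr_of_eventuallyEq (nhdsWithin_le_nhds hcoords)
    hcoords.self_of_nhds, ?_⟩
  ext w
  have hw := coords_eq_fderiv_transition h₀ h₁ (ofCoords x₁ (γ t) w)
  rw [coords_ofCoords h₁] at hw
  have h := covDerivForm_metricForm_transition h₀ h₁ (coords x₀ (γ t) (velocity γ t))
    (coords x₀ (γ t) (V t)) v' (coords x₀ (γ t) (ofCoords x₁ (γ t) w))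
  rw [hv, ← hw, ← coords_eq_fderiv_transition h₀ h₁, ← coords_eq_fderiv_transition h₀ h₁] at h
  exact h.symm

lemma IsParallelOn.add (hV : IsParallelOn γ V S) (hW : IsParallelOn γ W S) :
    IsParallelOn γ (fun t ↦ V t + W t) S := by
  rw [isParallelOn_iff_forall_isParallelWithinAt] at *
  intro t ht
  obtain ⟨v', hv', hv⟩ := hV t ht
  obtain ⟨w', hw', hw⟩ := hW t ht
  refine ⟨v' + w', ?_, ?_⟩
  · simpa only [coords_add] using hv'.fun_add hw'
  · rw [coords_add, covDerivForm_add, hv, hw, add_zero]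

lemma IsParallelOn.const_smul (hV : IsParallelOn γ V S) (c : ℝ) :
    IsParallelOn γ (fun t ↦ c • V t) S := by
  rw [isParallelOn_iff_forall_isParallelWithinAt] at *
  intro t ht
  obtain ⟨v', hv', hv⟩ := hV t ht
  refine ⟨c • v', ?_, ?_⟩
  · simpa only [coords_smul] using hv'.fun_const_smul c
  · rw [coords_smul, covDerivForm_smul, hv, smul_zero]

lemma IsParallelOn.hasDerivWithinAt_inner (hγ : MDifferentiable 𝓘(ℝ, ℝ) 𝓘(ℝ, E) γ)
    (hV : IsParallelOn γ V S) (hW : IsParallelOn γ W S) (ht : t ∈ S) :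
    HasDerivWithinAt (fun s ↦ inner ℝ (V s) (W s)) 0 S t := by
  rw [isParallelOn_iff_forall_isParallelWithinAt] at hV hW
  obtain ⟨v', hv', hv⟩ := hV t ht
  obtain ⟨w', hw', hw⟩ := hW t ht
  have h₀ := mem_chart_source E (γ t)
  have h := hasDerivWithinAt_bilin_comp (c := fun s ↦ extChartAt 𝓘(ℝ, E) (γ t) (γ s))
    (differentiableAt_metricForm h₀) (metricForm_symm (γ t))
    (coords_velocity (hγ t) h₀).hasDerivWithinAt hv' hw'
  rw [hv, hw, _root_.zero_apply, _root_.zero_apply, add_zero] at h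
  refine h.congr_of_eventuallyEq_of_mem (nhdsWithin_le_nhds ?_) ht
  filter_upwards [eventually_mem_chart_source (hγ t).continuousAt h₀] with s hs
  exact inner_eq_metricForm hs (V s) (W s)

lemma IsParallelOn.inner_eq (hγ : MDifferentiable 𝓘(ℝ, ℝ) 𝓘(ℝ, E) γ) (hS : Convex ℝ S)
    (hV : IsParallelOn γ V S) (hW : IsParallelOn γ W S) (hs : s ∈ S) (ht : t ∈ S) :
    inner ℝ (V s) (W s) = inner ℝ (V t) (W t) := by
  have h := hS.norm_image_sub_le_of_norm_hasDerivWithin_le (C := 0)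
    (f := fun s ↦ inner ℝ (V s) (W s)) (f' := fun _ ↦ 0)
    (fun x hx ↦ hV.hasDerivWithinAt_inner hγ hW hx) (by simp) ht hs
  rwa [zero_mul, norm_le_zero_iff, sub_eq_zero] at h

lemma IsParallelOn.eq_of_eq (hγ : MDifferentiable 𝓘(ℝ, ℝ) 𝓘(ℝ, E) γ) (hS : Convex ℝ S)
    (hV : IsParallelOn γ V S) (hW : IsParallelOn γ W S) (hs : s ∈ S) (ht : t ∈ S)
    (h : V s = W s) : V t = W t := by
  have hD := hV.add (hW.const_smul (-1))
  have hDt := hD.inner_eq hγ hS hD ht hs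
  simp only [h, neg_smul, one_smul, add_neg_cancel, inner_zero_left, inner_self_eq_zero] at hDt
  exact add_neg_eq_zero.1 hDt

lemma IsParallelOn.union (hS : IsClosed S) (hT : IsClosed T) (hVS : IsParallelOn γ V S)
    (hVT : IsParallelOn γ V T) : IsParallelOn γ V (S ∪ T) := by
  rw [isParallelOn_iff_forall_isParallelWithinAt] at *
  have hfar : ∀ R : Set ℝ, IsClosed R → ∀ t ∉ R, ∀ v' : E,
      HasDerivWithinAt (fun s ↦ coords (γ t) (γ s) (V s)) v' R t := fun R hR t ht v' ↦
    HasFDerivWithinAt.of_notMem_closure (by rwa [hR.closure_eq])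
  intro t ht
  by_cases htS : t ∈ S <;> by_cases htT : t ∈ T
  · obtain ⟨v', hv', hv⟩ := hVS t htS
    obtain ⟨w', hw', hw⟩ := hVT t htT
    obtain rfl : v' = w' := by
      rw [← hw, covDerivForm, covDerivForm, add_left_inj] at hv
      exact injective_metricForm (mem_chart_source E (γ t)) hv
    exact ⟨v', hv'.union hw', hv⟩
  · obtain ⟨v', hv', hv⟩ := hVS t htS
    exact ⟨v', hv'.union (hfar T hT t htT v'), hv⟩
  · obtain ⟨w', hw', hw⟩ := hVT t htT
    exact ⟨w', (hfar S hS t htS w').union hw', hw⟩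
  · exact absurd ht (not_or.2 ⟨htS, htT⟩)

lemma IsParallelOn.piecewise [∀ t, Decidable (t ∈ S)] (hS : IsClosed S) (hT : IsClosed T)
    (hV : IsParallelOn γ V S) (hW : IsParallelOn γ W T) (h : ∀ t ∈ S ∩ T, V t = W t) :
    IsParallelOn γ (S.piecewise V W) (S ∪ T) := by
  refine (hV.congr fun t ht ↦ S.piecewise_eq_of_mem V W ht).union hS hT (hW.congr fun t ht ↦ ?_)
  by_cases htS : t ∈ S
  · rw [S.piecewise_eq_of_mem V W htS, h t ⟨htS, ht⟩]
  · exact S.piecewise_eq_of_notMem V W htS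

end Parallel

section ParallelTransport

variable {E : Type*} [NormedAddCommGroup E] [NormedSpace ℝ E]
  {M : Type*} [TopologicalSpace M] [ChartedSpace E M] [IsManifold 𝓘(ℝ, E) ∞ M]
  [RiemannianBundle (fun x : M ↦ TangentSpace 𝓘(ℝ, E) x)]

/-- Every tangent vector at a time in `S` extends to a parallel field along `γ` over `S`. -/
def HasParallelFields (γ : ℝ → M) (S : Set ℝ) : Prop :=
  ∀ s ∈ S, ∀ u : TangentSpace 𝓘(ℝ, E) (γ s), ∃ V : ∀ t, TangentSpace 𝓘(ℝ, E) (γ t),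
    IsParallelOn γ V S ∧ V s = u

variable {γ : ℝ → M} {S T : Set ℝ} {a b t : ℝ}

lemma HasParallelFields.mono (h : HasParallelFields (E := E) γ S) (hTS : T ⊆ S) :
    HasParallelFields (E := E) γ T := by
  intro s hs u
  obtain ⟨V, hV, hVs⟩ := h s (hTS hs) u
  exact ⟨V, hV.mono hTS, hVs⟩

variable [FiniteDimensional ℝ E]
  [IsContMDiffRiemannianBundle 𝓘(ℝ, E) 1 E (fun x : M ↦ TangentSpace 𝓘(ℝ, E) x)]

open Classical in
lemma HasParallelFields.exists_isParallelOn_union (hS : IsClosed S) (hT : IsClosed T)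
    (hγS : HasParallelFields (E := E) γ S) (hγT : HasParallelFields (E := E) γ T)
    (hc : S ∩ T = {t}) {s : ℝ} (hs : s ∈ S) (u : TangentSpace 𝓘(ℝ, E) (γ s)) :
    ∃ V : ∀ t, TangentSpace 𝓘(ℝ, E) (γ t), IsParallelOn γ V (S ∪ T) ∧ V s = u := by
  obtain ⟨V, hV, hVs⟩ := hγS s hs u
  obtain ⟨W, hW, hWt⟩ := hγT t (hc.ge rfl).2 (V t)
  refine ⟨S.piecewise V W, hV.piecewise hS hT hW ?_, by rw [S.piecewise_eq_of_mem V W hs, hVs]⟩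
  rw [hc]
  rintro _ rfl
  exact hWt.symm

lemma HasParallelFields.union (hS : IsClosed S) (hT : IsClosed T)
    (hγS : HasParallelFields (E := E) γ S) (hγT : HasParallelFields (E := E) γ T)
    (hc : S ∩ T = {t}) : HasParallelFields (E := E) γ (S ∪ T) := by
  rintro s (hs | hs) u
  · exact hγS.exists_isParallelOn_union hS hT hγT hc hs u
  · rw [Set.union_comm]
    exact hγT.exists_isParallelOn_union hT hS hγS (Set.inter_comm S T ▸ hc) hs u

lemma eventually_hasParallelFields (hγ : ContMDiff 𝓘(ℝ, ℝ) 𝓘(ℝ, E) 1 γ) (t₀ : ℝ) :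
    ∀ᶠ δ in nhds (0 : ℝ), HasParallelFields (E := E) γ (Metric.closedBall t₀ δ) := by
  set x₀ := γ t₀
  have hsource : ∀ᶠ t in nhds t₀, γ t ∈ (chartAt E x₀).source :=
    eventually_mem_chart_source hγ.continuous.continuousAt (mem_chart_source E x₀)
  set A : ℝ → E →L[ℝ] E := fun t ↦ transportOperator (metricForm x₀)
    (extChartAt 𝓘(ℝ, E) x₀ (γ t)) (coords x₀ (γ t) (velocity γ t))
  have hA : ∀ᶠ t in nhds t₀, ContinuousAt A t := hsource.mono fun t ht ↦
    continuousAt_transportOperator (contDiffAt_metricForm ht) (isInvertible_metricForm ht)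
      ((continuousAt_extChartAt' (by rwa [extChartAt_source])).comp hγ.continuous.continuousAt)
      (continuousAt_coords_velocity hγ ht)
  filter_upwards [eventually_closedBall_subset hsource,
    eventually_exists_linear_ode_solution hA] with δ hδ hode s hs u
  obtain ⟨U, hUs, hU⟩ := hode s hs (coords x₀ (γ s) u)
  refine ⟨fun t ↦ ofCoords x₀ (γ t) (U t), ?_,
    (congrArg (ofCoords x₀ (γ s)) hUs).trans (ofCoords_coords (hδ hs) u)⟩
  refine isParallelOn_iff_forall_isParallelWithinAt.2 fun t ht ↦
    IsParallelWithinAt.of_chart (hγ.mdifferentiable one_ne_zero t) (hδ ht)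
      (mem_chart_source E (γ t)) ⟨A t (U t), (hU t ht).congr (fun r hr ↦ ?_) ?_, ?_⟩
  · exact coords_ofCoords (hδ hr) (U r)
  · exact coords_ofCoords (hδ ht) (U t)
  · rw [coords_ofCoords (hδ ht)]
    exact covDerivForm_transportOperator (isInvertible_metricForm (hδ ht)) _ _

lemma hasParallelFields_Icc (hγ : ContMDiff 𝓘(ℝ, ℝ) 𝓘(ℝ, E) 1 γ) (hab : a ≤ b) :
    HasParallelFields (E := E) γ (Set.Icc a b) := by
  have hloc : ∀ t₀, ∃ δ > 0, HasParallelFields (E := E) γ (Metric.closedBall t₀ δ) := fun t₀ ↦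
    ((eventually_mem_nhdsWithin (a := (0 : ℝ)) (s := Set.Ioi 0)).and
      (nhdsWithin_le_nhds (eventually_hasParallelFields hγ t₀))).exists
  choose δ hδ hloc using hloc
  obtain ⟨t, ht₀, hmono, ⟨m, hm⟩, hcov⟩ := exists_monotone_Icc_subset_open_cover_Icc hab
    (c := fun t₀ : ℝ ↦ (Subtype.val ⁻¹' Metric.ball t₀ (δ t₀) : Set (Set.Icc a b)))
    (fun t₀ ↦ Metric.isOpen_ball.preimage continuous_subtype_val)
    (fun x _ ↦ Set.mem_iUnion.2 ⟨x, Metric.mem_ball_self (hδ x)⟩)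
  have hpiece : ∀ k, HasParallelFields (E := E) γ (Set.Icc (t k) (t (k + 1))) := by
    intro k
    obtain ⟨t₀, ht₀⟩ := hcov k
    refine (hloc t₀).mono fun x hx ↦ Metric.ball_subset_closedBall ?_
    exact ht₀ (show (⟨x, (t k).2.1.trans hx.1, hx.2.trans (t (k + 1)).2.2⟩ : Set.Icc a b)
      ∈ Set.Icc (t k) (t (k + 1)) from hx)
  have hpieces : ∀ k, HasParallelFields (E := E) γ (Set.Icc (t 0) (t (k + 1))) := by
    intro k
    induction k with
    | zero => exact hpiece 0
    | succ k ih =>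
      have hle : (t 0 : ℝ) ≤ t (k + 1) := hmono (Nat.zero_le _)
      have hle' : (t (k + 1) : ℝ) ≤ t (k + 1 + 1) := hmono (Nat.le_succ _)
      rw [← Set.Icc_union_Icc_eq_Icc hle hle']
      exact ih.union isClosed_Icc isClosed_Icc (hpiece (k + 1))
        (Set.Icc_inter_Icc_eq_singleton hle hle')
  simpa only [ht₀, hm (m + 1) (Nat.le_succ m)] using hpieces m

lemma exists_isParallelOn_uIcc (hγ : ContMDiff 𝓘(ℝ, ℝ) 𝓘(ℝ, E) 1 γ) (a b : ℝ)
    (u : TangentSpace 𝓘(ℝ, E) (γ a)) : ∃ V : ∀ t, TangentSpace 𝓘(ℝ, E) (γ t),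
      IsParallelOn γ V (Set.uIcc a b) ∧ V a = u :=
  hasParallelFields_Icc hγ inf_le_sup a Set.left_mem_uIcc u

lemma parallelTransport_eq (hγ : MDifferentiable 𝓘(ℝ, ℝ) 𝓘(ℝ, E) γ)
    {V : ∀ t, TangentSpace 𝓘(ℝ, E) (γ t)} (hV : IsParallelOn γ V (Set.uIcc a b)) :
    parallelTransport γ a b ⟨γ a, V a⟩ = V b := by
  have h : ∃ W : ∀ t, TangentSpace 𝓘(ℝ, E) (γ t), IsParallelOn γ W (Set.uIcc a b) ∧
      (⟨γ a, W a⟩ : TangentBundle 𝓘(ℝ, E) M) = ⟨γ a, V a⟩ := ⟨V, hV, rfl⟩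
  rw [parallelTransport, dif_pos h]
  obtain ⟨hW, hWa⟩ := h.choose_spec
  exact hW.eq_of_eq hγ (convex_uIcc a b) hV Set.left_mem_uIcc Set.right_mem_uIcc
    (TotalSpace.mk_inj.1 hWa)

/-- Parallel transport along a `C¹` curve, as a linear isometry of tangent spaces. -/
def transportEquiv (hγ : ContMDiff 𝓘(ℝ, ℝ) 𝓘(ℝ, E) 1 γ) (a b : ℝ) :
    TangentSpace 𝓘(ℝ, E) (γ a) ≃ₗᵢ[ℝ] TangentSpace 𝓘(ℝ, E) (γ b) where
  toFun u := parallelTransport γ a b ⟨γ a, u⟩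
  invFun w := parallelTransport γ b a ⟨γ b, w⟩
  map_add' u v := by
    have hγ' := hγ.mdifferentiable one_ne_zero
    obtain ⟨U, hU, rfl⟩ := exists_isParallelOn_uIcc hγ a b u
    obtain ⟨V, hV, rfl⟩ := exists_isParallelOn_uIcc hγ a b v
    rw [parallelTransport_eq hγ' hU, parallelTransport_eq hγ' hV]
    exact parallelTransport_eq hγ' (hU.add hV)
  map_smul' c u := by
    have hγ' := hγ.mdifferentiable one_ne_zero
    obtain ⟨U, hU, rfl⟩ := exists_isParallelOn_uIcc hγ a b u
    rw [parallelTransport_eq hγ' hU]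
    exact parallelTransport_eq hγ' (hU.const_smul c)
  left_inv u := by
    have hγ' := hγ.mdifferentiable one_ne_zero
    obtain ⟨U, hU, rfl⟩ := exists_isParallelOn_uIcc hγ a b u
    beta_reduce
    rw [parallelTransport_eq hγ' hU]
    exact parallelTransport_eq hγ' (Set.uIcc_comm a b ▸ hU)
  right_inv u := by
    have hγ' := hγ.mdifferentiable one_ne_zero
    obtain ⟨U, hU, rfl⟩ := exists_isParallelOn_uIcc hγ b a u
    beta_reduce
    rw [parallelTransport_eq hγ' hU]
    exact parallelTransport_eq hγ' (Set.uIcc_comm b a ▸ hU)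
  norm_map' u := by
    have hγ' := hγ.mdifferentiable one_ne_zero
    obtain ⟨U, hU, rfl⟩ := exists_isParallelOn_uIcc hγ a b u
    change ‖parallelTransport γ a b ⟨γ a, U a⟩‖ = _
    rw [parallelTransport_eq hγ' hU, ← sq_eq_sq₀ (norm_nonneg _) (norm_nonneg _),
      ← real_inner_self_eq_norm_sq, ← real_inner_self_eq_norm_sq]
    exact hU.inner_eq hγ' (convex_uIcc a b) hU Set.right_mem_uIcc Set.left_mem_uIcc

end ParallelTransport

section Gradient

variable {E : Type*} [NormedAddCommGroup E] [NormedSpace ℝ E] [FiniteDimensional ℝ E]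
  {M : Type*} [TopologicalSpace M] [ChartedSpace E M]
  [RiemannianBundle (fun x : M ↦ TangentSpace 𝓘(ℝ, E) x)]

lemma inner_riemGrad (f : M → ℝ) (x : M) (v : TangentSpace 𝓘(ℝ, E) x) :
    inner ℝ (riemGrad f x) v = mvfderiv 𝓘(ℝ, E) f x v := by
  rw [riemGrad, InnerProductSpace.toDual_symm_apply]

lemma hasDerivAt_comp_curve {f : M → ℝ} {γ : ℝ → M} {t : ℝ}
    (hf : MDifferentiableAt 𝓘(ℝ, E) 𝓘(ℝ, ℝ) f (γ t))
    (hγ : MDifferentiableAt 𝓘(ℝ, ℝ) 𝓘(ℝ, E) γ t) :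
    HasDerivAt (fun s ↦ f (γ s)) (inner ℝ (riemGrad f (γ t)) (velocity (E := E) γ t)) t := by
  rw [inner_riemGrad]
  let D : ℝ →L[ℝ] ℝ :=
    (mfderiv 𝓘(ℝ, E) 𝓘(ℝ, ℝ) f (γ t)).comp (mfderiv 𝓘(ℝ, ℝ) 𝓘(ℝ, E) γ t)
  have hD : HasFDerivAt (fun s ↦ f (γ s)) D t :=
    (hf.hasMFDerivAt.comp t hγ.hasMFDerivAt).hasFDerivAt
  exact hD.hasDerivAt

lemma riemGrad_objective {n : ℕ} {f : Fin n → M → ℝ}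
    (hf : ∀ i, MDifferentiable 𝓘(ℝ, E) 𝓘(ℝ, ℝ) (f i)) (x : M) :
    riemGrad (E := E) (objective f) x = batchGrad f Finset.univ x := by
  have hi : ∀ i ∈ Finset.univ, HasMFDerivAt 𝓘(ℝ, E) 𝓘(ℝ, ℝ) (f i) x
      (mvfderiv 𝓘(ℝ, E) (f i) x : TangentSpace 𝓘(ℝ, E) x →L[ℝ] ℝ) :=
    fun i _ ↦ (hf i x).hasMFDerivAt
  have hsum := (HasMFDerivAt.sum hi).const_smul (n : ℝ)⁻¹
  have hobj : (n : ℝ)⁻¹ • ∑ i, f i = objective f := by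
    ext y
    simp [objective, div_eq_inv_mul]
  rw [hobj] at hsum
  have hD : mvfderiv 𝓘(ℝ, E) (objective f) x
      = (n : ℝ)⁻¹ • ∑ i, (mvfderiv 𝓘(ℝ, E) (f i) x : TangentSpace 𝓘(ℝ, E) x →L[ℝ] ℝ) :=
    hsum.mfderiv
  refine ext_inner_right ℝ fun v ↦ ?_
  rw [inner_riemGrad, batchGrad, real_inner_smul_left, sum_inner, hD]
  simp [inner_riemGrad]

end Gradient

section Geodesics

variable {E : Type*} [NormedAddCommGroup E] [NormedSpace ℝ E]
  {M : Type*} [TopologicalSpace M] [ChartedSpace E M] [IsManifold 𝓘(ℝ, E) ∞ M]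
  [RiemannianBundle (fun x : M ↦ TangentSpace 𝓘(ℝ, E) x)]
  {γ : ℝ → M}

lemma IsGeodesic.contMDiff_one (hγ : IsGeodesic (E := E) γ) :
    ContMDiff 𝓘(ℝ, ℝ) 𝓘(ℝ, E) 1 γ := hγ.1.of_le (by simp)

variable [FiniteDimensional ℝ E]
  [IsContMDiffRiemannianBundle 𝓘(ℝ, E) 1 E (fun x : M ↦ TangentSpace 𝓘(ℝ, E) x)]

lemma IsGeodesic.comp_mul (hγ : IsGeodesic (E := E) γ) (c : ℝ) :
    IsGeodesic (E := E) (fun r ↦ γ (c * r)) := by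
  refine ⟨hγ.1.comp (contDiff_const.mul contDiff_id).contMDiff, ?_⟩
  have hmul : ∀ t, HasDerivAt (fun r : ℝ ↦ c * r) c t := fun t ↦ by
    simpa using (hasDerivAt_id t).const_mul c
  have hvel : ∀ t, velocity (E := E) (fun r ↦ γ (c * r)) t = c • velocity (E := E) γ (c * t) :=
    fun t ↦ velocity_comp_mul (hγ.contMDiff_one.mdifferentiable one_ne_zero _)
  have hpar := isParallelOn_iff_forall_isParallelWithinAt.1 hγ.2
  refine isParallelOn_iff_forall_isParallelWithinAt.2 fun t _ ↦ ?_
  obtain ⟨v', hv', hv⟩ := hpar (c * t) (Set.mem_univ _)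
  rw [hasDerivWithinAt_univ] at hv'
  refine ⟨c • c • v', ?_, ?_⟩
  · rw [hasDerivWithinAt_univ]
    simpa only [hvel, coords_smul, Function.comp_def] using (hv'.scomp t (hmul t)).fun_const_smul c
  · rw [hvel, coords_smul, covDerivForm_smul_velocity, covDerivForm_smul, hv, smul_zero, smul_zero]

lemma transportEquiv_symm_apply (hγ : ContMDiff 𝓘(ℝ, ℝ) 𝓘(ℝ, E) 1 γ) (a b : ℝ)
    (u : TangentSpace 𝓘(ℝ, E) (γ b)) :
    (transportEquiv hγ a b).symm u = parallelTransport γ b a ⟨γ b, u⟩ := rfl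

lemma IsGeodesic.transportEquiv_velocity (hγ : IsGeodesic (E := E) γ) (a b : ℝ) :
    transportEquiv hγ.contMDiff_one a b (velocity γ a) = velocity γ b :=
  parallelTransport_eq (hγ.contMDiff_one.mdifferentiable one_ne_zero)
    (hγ.2.mono (Set.subset_univ _))

end Geodesics

section Descent

lemma image_one_le_of_deriv_le {φ φ' : ℝ → ℝ} {C : ℝ} (hφ : ∀ t, HasDerivAt φ (φ' t) t)
    (hφ' : ∀ t, 0 < t → φ' t ≤ φ' 0 + C * t) : φ 1 ≤ φ 0 + φ' 0 + C / 2 := by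
  have hψ : ∀ t, HasDerivAt (fun s ↦ φ s - (φ' 0 * s + C / 2 * s ^ 2))
      (φ' t - (φ' 0 + C * t)) t := fun t ↦
    ((hφ t).sub (((hasDerivAt_id t).const_mul (φ' 0)).add
      ((hasDerivAt_pow 2 t).const_mul (C / 2)))).congr_deriv (by push_cast; ring)
  have hanti : AntitoneOn (fun s ↦ φ s - (φ' 0 * s + C / 2 * s ^ 2)) (Set.Icc 0 1) := by
    refine antitoneOn_of_deriv_nonpos (convex_Icc 0 1)
      (fun t _ ↦ (hψ t).continuousAt.continuousWithinAt)
      (fun t _ ↦ (hψ t).differentiableAt.differentiableWithinAt) fun t ht ↦ ?_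
    rw [interior_Icc] at ht
    rw [(hψ t).deriv]
    exact sub_nonpos.2 (hφ' t ht.1)
  have h := hanti (Set.left_mem_Icc.2 zero_le_one) (Set.right_mem_Icc.2 zero_le_one) zero_le_one
  linarith

variable {E : Type*} [NormedAddCommGroup E] [NormedSpace ℝ E] [FiniteDimensional ℝ E]
  {M : Type*} [TopologicalSpace M] [ChartedSpace E M] [IsManifold 𝓘(ℝ, E) ∞ M]
  [RiemannianBundle (fun x : M ↦ TangentSpace 𝓘(ℝ, E) x)]
  [IsContMDiffRiemannianBundle 𝓘(ℝ, E) 1 E (fun x : M ↦ TangentSpace 𝓘(ℝ, E) x)]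
  {f : M → ℝ} {γ : ℝ → M} {t : ℝ}

lemma IsGSmooth.norm_sub_transport_le {L : ℝ} (hf : IsGSmooth E L f)
    (hγ : IsGeodesic (E := E) γ) :
    ‖riemGrad (E := E) f (γ 1) - transportEquiv hγ.contMDiff_one 0 1 (riemGrad f (γ 0))‖
      ≤ L * ‖velocity (E := E) γ 0‖ := by
  have h := hf.2 γ hγ
  rw [← transportEquiv_symm_apply hγ.contMDiff_one 0 1,
    ← (transportEquiv hγ.contMDiff_one 0 1).norm_map, map_sub,
    LinearIsometryEquiv.apply_symm_apply, norm_sub_rev] at h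
  exact h

lemma IsGSmooth.inner_sub_inner_le {L : ℝ} (hf : IsGSmooth E L f)
    (hγ : IsGeodesic (E := E) γ) :
    inner ℝ (riemGrad f (γ 1)) (velocity (E := E) γ 1)
      - inner ℝ (riemGrad f (γ 0)) (velocity (E := E) γ 0) ≤ L * ‖velocity (E := E) γ 0‖ ^ 2 := by
  rw [← hγ.transportEquiv_velocity 0 1, ← (transportEquiv hγ.contMDiff_one 0 1).inner_map_map
    (riemGrad f (γ 0)) (velocity γ 0), ← inner_sub_left]
  refine (real_inner_le_norm _ _).trans ?_
  rw [LinearIsometryEquiv.norm_map, sq, ← mul_assoc]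
  exact mul_le_mul_of_nonneg_right (hf.norm_sub_transport_le hγ) (norm_nonneg _)

lemma IsGSmooth.inner_velocity_le {L : ℝ} (hf : IsGSmooth E L f) (hγ : IsGeodesic (E := E) γ)
    (ht : 0 < t) :
    inner ℝ (riemGrad f (γ t)) (velocity (E := E) γ t)
      ≤ inner ℝ (riemGrad f (γ 0)) (velocity (E := E) γ 0)
        + L * ‖velocity (E := E) γ 0‖ ^ 2 * t := by
  have hvel : ∀ s, velocity (E := E) (fun r ↦ γ (t * r)) s = t • velocity (E := E) γ (t * s) :=
    fun s ↦ velocity_comp_mul (hγ.contMDiff_one.mdifferentiable one_ne_zero _)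
  have h := hf.inner_sub_inner_le (hγ.comp_mul t)
  rw [hvel, hvel, inner_smul_right, inner_smul_right, norm_smul, Real.norm_of_nonneg ht.le] at h
  rw [mul_one, mul_zero] at h
  have hmul : t * (inner ℝ (riemGrad f (γ t)) (velocity (E := E) γ t)
      - inner ℝ (riemGrad f (γ 0)) (velocity (E := E) γ 0))
      ≤ t * (L * ‖velocity (E := E) γ 0‖ ^ 2 * t) := by linarith
  linarith [le_of_mul_le_mul_left hmul ht]

lemma IsGSmooth.descent {L : ℝ} (hf : IsGSmooth E L f) (hγ : IsGeodesic (E := E) γ) :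
    f (γ 1) ≤ f (γ 0) + inner ℝ (riemGrad f (γ 0)) (velocity (E := E) γ 0)
      + L * ‖velocity (E := E) γ 0‖ ^ 2 / 2 :=
  image_one_le_of_deriv_le (φ := fun t ↦ f (γ t))
    (fun t ↦ hasDerivAt_comp_curve (hf.1 _) (hγ.contMDiff_one.mdifferentiable one_ne_zero t))
    fun _ ht ↦ hf.inner_velocity_le hγ ht

lemma objective_descent {n : ℕ} (hn : n ≠ 0) {L : ℝ} {f : Fin n → M → ℝ}
    (hf : ∀ i, IsGSmooth E L (f i)) (hγ : IsGeodesic (E := E) γ) :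
    objective f (γ 1) ≤ objective f (γ 0)
      + inner ℝ (batchGrad f Finset.univ (γ 0)) (velocity (E := E) γ 0)
      + L * ‖velocity (E := E) γ 0‖ ^ 2 / 2 := by
  have hn' : (0 : ℝ) < n := by positivity
  have h := Finset.sum_le_sum fun i (_ : i ∈ Finset.univ) ↦ (hf i).descent hγ
  rw [Finset.sum_add_distrib, Finset.sum_add_distrib, ← sum_inner, Finset.sum_const,
    Finset.card_univ, Fintype.card_fin, nsmul_eq_mul] at h
  rw [objective, objective, batchGrad, real_inner_smul_left, Finset.card_univ, Fintype.card_fin,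
    div_le_iff₀ hn']
  refine h.trans (le_of_eq ?_)
  field_simp

end Descent

section Sampling

open Finset

variable {ι : Type*} {H : Type*} [NormedAddCommGroup H] [InnerProductSpace ℝ H]

lemma sum_sub_mean (X : ι → H) (s : Finset ι) :
    ∑ i ∈ s, (X i - (#s : ℝ)⁻¹ • ∑ j ∈ s, X j) = 0 := by
  rcases s.eq_empty_or_nonempty with rfl | hs
  · exact sum_empty
  rw [sum_sub_distrib, sum_const, ← Nat.cast_smul_eq_nsmul ℝ,
    smul_inv_smul₀ (by exact_mod_cast hs.card_pos.ne'), sub_self]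

lemma sum_norm_sub_mean_sq_le (X : ι → H) (s : Finset ι) :
    ∑ i ∈ s, ‖X i - (#s : ℝ)⁻¹ • ∑ j ∈ s, X j‖ ^ 2 ≤ ∑ i ∈ s, ‖X i‖ ^ 2 := by
  set m := (#s : ℝ)⁻¹ • ∑ j ∈ s, X j
  have hsplit : ∀ i ∈ s, ‖X i‖ ^ 2 = ‖X i - m‖ ^ 2 + 2 * inner ℝ (X i - m) m + ‖m‖ ^ 2 :=
    fun i _ ↦ by rw [← norm_add_sq_real, sub_add_cancel]
  rw [sum_congr rfl hsplit, sum_add_distrib, sum_add_distrib, ← mul_sum, ← sum_inner,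
    sum_sub_mean, inner_zero_left, mul_zero, add_zero]
  exact le_add_of_nonneg_right (by positivity)

variable {s : Finset ι} {b : ℕ}

lemma exists_card_filter_subset_powersetCard [DecidableEq ι] (s : Finset ι) (b k : ℕ) :
    ∃ c, ∀ t ⊆ s, #t = k → #{S ∈ s.powersetCard b | t ⊆ S} = c := by
  by_cases hk : k ≤ b
  · refine ⟨(#s - k).choose (b - k), ?_⟩
    rintro t hts rfl
    exact card_filter_powersetCard_subset t s b hts hk
  · refine ⟨0, fun t _ ht ↦ ?_⟩
    rw [card_eq_zero, filter_eq_empty_iff]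
    intro S hS htS
    have hcard := card_le_card htS
    rw [ht, (mem_powersetCard.1 hS).2] at hcard
    exact hk hcard

lemma card_mul_card_filter_mem_powersetCard [DecidableEq ι] {i : ι} (hi : i ∈ s) (b : ℕ) :
    #s * #{S ∈ s.powersetCard b | i ∈ S} = b * #(s.powersetCard b) := by
  obtain ⟨c, hc⟩ := exists_card_filter_subset_powersetCard s b 1
  have hcount : ∀ j ∈ s, #{S ∈ s.powersetCard b | j ∈ S} = c := fun j hj ↦ by
    simpa only [singleton_subset_iff] using
      hc {j} (singleton_subset_iff.2 hj) (card_singleton j)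
  have hdouble := sum_card_bipartiteAbove_eq_sum_card_bipartiteBelow
    (s := s) (t := s.powersetCard b) (fun j S ↦ j ∈ S)
  have hsize : ∀ S ∈ s.powersetCard b, #(s.bipartiteBelow (fun j S ↦ j ∈ S) S) = b := by
    intro S hS
    obtain ⟨hSs, hSb⟩ := mem_powersetCard.1 hS
    rw [bipartiteBelow, filter_mem_eq_inter, inter_eq_right.2 hSs, hSb]
  simp only [bipartiteAbove] at hdouble
  rw [sum_congr rfl hcount, sum_congr rfl hsize, sum_const, sum_const, smul_eq_mul,
    smul_eq_mul] at hdouble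
  rw [hcount i hi, hdouble, mul_comm]

lemma sum_powersetCard_sum_eq_zero {A : Type*} [AddCommGroup A] {Y : ι → A}
    (hY : ∑ i ∈ s, Y i = 0) (b : ℕ) : ∑ S ∈ s.powersetCard b, ∑ i ∈ S, Y i = 0 := by
  classical
  obtain ⟨c, hc⟩ := exists_card_filter_subset_powersetCard s b 1
  have hswap : ∑ S ∈ s.powersetCard b, ∑ i ∈ S, Y i
      = ∑ i ∈ s, ∑ S ∈ s.powersetCard b with i ∈ S, Y i :=
    sum_comm' fun S i ↦ by grind
  have hcount : ∀ i ∈ s, ∑ S ∈ s.powersetCard b with i ∈ S, Y i = c • Y i := fun i hi ↦ by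
    rw [sum_const, ← hc {i} (singleton_subset_iff.2 hi) (card_singleton i)]
    simp only [singleton_subset_iff]
  rw [hswap, sum_congr rfl hcount, ← smul_sum, hY, smul_zero]

lemma sum_powersetCard_norm_sum_sq [DecidableEq ι] (Y : ι → H) (s : Finset ι) (b : ℕ) :
    ∑ S ∈ s.powersetCard b, ‖∑ i ∈ S, Y i‖ ^ 2
      = ∑ i ∈ s, ∑ j ∈ s, #{S ∈ s.powersetCard b | {i, j} ⊆ S} * inner ℝ (Y i) (Y j) := by
  have hexpand : ∀ S ∈ s.powersetCard b, ‖∑ i ∈ S, Y i‖ ^ 2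
      = ∑ q ∈ S ×ˢ S, inner ℝ (Y q.1) (Y q.2) := fun S _ ↦ by
    rw [← real_inner_self_eq_norm_sq, sum_inner, sum_product]
    simp only [inner_sum]
  have hswap : ∑ S ∈ s.powersetCard b, ∑ q ∈ S ×ˢ S, inner ℝ (Y q.1) (Y q.2)
      = ∑ q ∈ s ×ˢ s, ∑ S ∈ s.powersetCard b with {q.1, q.2} ⊆ S, inner ℝ (Y q.1) (Y q.2) :=
    sum_comm' fun S q ↦ by grind
  rw [sum_congr rfl hexpand, hswap, sum_product]
  simp only [sum_const, nsmul_eq_mul]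

/-- All pairs `i ≠ j` lie in the same number of samples, so that their contributions form a
nonnegative multiple of `‖∑ Y‖² - ∑ ‖Y‖²`. -/
lemma sum_powersetCard_norm_sum_sq_le [DecidableEq ι] {Y : ι → H} (hY : ∑ i ∈ s, Y i = 0)
    (b : ℕ) :
    ∑ S ∈ s.powersetCard b, ‖∑ i ∈ S, Y i‖ ^ 2
      ≤ ∑ i ∈ s, #{S ∈ s.powersetCard b | i ∈ S} * ‖Y i‖ ^ 2 := by
  obtain ⟨c, hc⟩ := exists_card_filter_subset_powersetCard s b 2
  have hpair : ∀ i ∈ s, ∀ j ∈ s,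
      (#{S ∈ s.powersetCard b | {i, j} ⊆ S} : ℝ) * inner ℝ (Y i) (Y j)
        = c * inner ℝ (Y i) (Y j)
          + if i = j then (#{S ∈ s.powersetCard b | i ∈ S} - c : ℝ) * ‖Y i‖ ^ 2 else 0 := by
    intro i hi j hj
    split_ifs with hij
    · subst hij
      simp only [pair_eq_singleton, singleton_subset_iff, real_inner_self_eq_norm_sq]
      ring
    · rw [hc {i, j} (insert_subset hi (singleton_subset_iff.2 hj)) (card_pair hij), add_zero]
  have hrow : ∀ i ∈ s,
      ∑ j ∈ s, (#{S ∈ s.powersetCard b | {i, j} ⊆ S} : ℝ) * inner ℝ (Y i) (Y j)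
        = (#{S ∈ s.powersetCard b | i ∈ S} - c : ℝ) * ‖Y i‖ ^ 2 := by
    intro i hi
    rw [sum_congr rfl (hpair i hi), sum_add_distrib, ← mul_sum, ← inner_sum, hY,
      inner_zero_right, mul_zero, zero_add, sum_ite_eq, if_pos hi]
  rw [sum_powersetCard_norm_sum_sq, sum_congr rfl hrow]
  gcongr
  exact sub_le_self _ (Nat.cast_nonneg c)

lemma expect_powersetCard_norm_sum_sq_le {Y : ι → H} (hY : ∑ i ∈ s, Y i = 0) (b : ℕ) :
    𝔼 S ∈ s.powersetCard b, ‖∑ i ∈ S, Y i‖ ^ 2 ≤ b * 𝔼 i ∈ s, ‖Y i‖ ^ 2 := by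
  classical
  rcases (s.powersetCard b).eq_empty_or_nonempty with hP | hP
  · rw [hP, expect_empty]
    positivity
  have hP₀ : (0 : ℝ) < #(s.powersetCard b) := by exact_mod_cast hP.card_pos
  have hcount : ∀ i ∈ s, (#{S ∈ s.powersetCard b | i ∈ S} : ℝ) * ‖Y i‖ ^ 2
      = b * #(s.powersetCard b) / #s * ‖Y i‖ ^ 2 := fun i hi ↦ by
    have hs : (#s : ℝ) ≠ 0 := by exact_mod_cast (card_pos.2 ⟨i, hi⟩).ne'
    congr 1
    rw [eq_div_iff hs, mul_comm]
    exact_mod_cast card_mul_card_filter_mem_powersetCard hi b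
  rw [expect_eq_sum_div_card, expect_eq_sum_div_card, div_le_iff₀ hP₀]
  refine (sum_powersetCard_norm_sum_sq_le hY b).trans (le_of_eq ?_)
  rw [sum_congr rfl hcount, ← mul_sum]
  ring

lemma expect_norm_add_sampling_error_sq_le (hb : 1 ≤ b) (X : ι → H) (s : Finset ι) (e : H) :
    𝔼 S ∈ s.powersetCard b,
        ‖e + ((#S : ℝ)⁻¹ • ∑ i ∈ S, X i - (#s : ℝ)⁻¹ • ∑ i ∈ s, X i)‖ ^ 2
      ≤ ‖e‖ ^ 2 + (𝔼 i ∈ s, ‖X i‖ ^ 2) / b := by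
  rcases (s.powersetCard b).eq_empty_or_nonempty with hP | hP
  · rw [hP, expect_empty]
    positivity
  have hb₀ : (0 : ℝ) < b := by exact_mod_cast hb
  set m := (#s : ℝ)⁻¹ • ∑ i ∈ s, X i
  have hexpand : ∀ S ∈ s.powersetCard b, ‖e + ((#S : ℝ)⁻¹ • ∑ i ∈ S, X i - m)‖ ^ 2
      = ‖e‖ ^ 2 + 2 * (b : ℝ)⁻¹ * inner ℝ e (∑ i ∈ S, (X i - m))
        + ((b : ℝ)⁻¹) ^ 2 * ‖∑ i ∈ S, (X i - m)‖ ^ 2 := by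
    intro S hS
    have hmean : (#S : ℝ)⁻¹ • ∑ i ∈ S, X i - m = (b : ℝ)⁻¹ • ∑ i ∈ S, (X i - m) := by
      rw [sum_sub_distrib, sum_const, (mem_powersetCard.1 hS).2, smul_sub,
        ← Nat.cast_smul_eq_nsmul ℝ, inv_smul_smul₀ hb₀.ne']
    rw [hmean, norm_add_sq_real, inner_smul_right, norm_smul, mul_pow, Real.norm_of_nonneg
      (by positivity)]
    ring
  have hcross : 𝔼 S ∈ s.powersetCard b, inner ℝ e (∑ i ∈ S, (X i - m)) = 0 := by
    rw [expect_eq_sum_div_card, ← inner_sum, sum_powersetCard_sum_eq_zero (sum_sub_mean X s) b,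
      inner_zero_right, zero_div]
  have hcentre : 𝔼 i ∈ s, ‖X i - m‖ ^ 2 ≤ 𝔼 i ∈ s, ‖X i‖ ^ 2 := by
    rw [expect_eq_sum_div_card, expect_eq_sum_div_card]
    exact div_le_div_of_nonneg_right (sum_norm_sub_mean_sq_le X s) (Nat.cast_nonneg _)
  rw [expect_congr rfl hexpand, expect_add_distrib, expect_add_distrib, expect_const hP,
    ← mul_expect, ← mul_expect, hcross, mul_zero, add_zero]
  gcongr
  calc ((b : ℝ)⁻¹) ^ 2 * 𝔼 S ∈ s.powersetCard b, ‖∑ i ∈ S, (X i - m)‖ ^ 2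
      ≤ ((b : ℝ)⁻¹) ^ 2 * (b * 𝔼 i ∈ s, ‖X i‖ ^ 2) := by
        gcongr
        exact (expect_powersetCard_norm_sum_sq_le (sum_sub_mean X s) b).trans (by gcongr)
    _ = (𝔼 i ∈ s, ‖X i‖ ^ 2) / b := by field_simp

end Sampling

section FiniteRandomVariables

variable {Ω : Type*} [MeasurableSpace Ω] {P : Measure Ω} [IsProbabilityMeasure P]
  {α : Type*} [MeasurableSpace α] [DiscreteMeasurableSpace α] {X : Ω → α}

lemma integrable_comp_of_finite [Finite α] (hX : Measurable X) (h : α → ℝ) :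
    Integrable (fun ξ ↦ h (X ξ)) P :=
  have : IsProbabilityMeasure (P.map X) := Measure.isProbabilityMeasure_map hX.aemeasurable
  (Integrable.of_finite (μ := P.map X) (f := h)).comp_measurable hX

lemma integral_comp_eq_sum [Fintype α] (hX : Measurable X) (h : α → ℝ) :
    ∫ ξ, h (X ξ) ∂P = ∑ a, P.real {ξ | X ξ = a} * h a := by
  have : IsProbabilityMeasure (P.map X) := Measure.isProbabilityMeasure_map hX.aemeasurable
  rw [← integral_map hX.aemeasurable (Integrable.of_finite (μ := P.map X)).aestronglyMeasurable,
    integral_fintype Integrable.of_finite]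
  refine Finset.sum_congr rfl fun a _ ↦ ?_
  rw [map_measureReal_apply hX (measurableSet_singleton a), smul_eq_mul]
  rfl

lemma integral_comp_indepFun [Finite α] {β : Type*} [Finite β] [MeasurableSpace β]
    [DiscreteMeasurableSpace β] {Z : Ω → β} (hX : Measurable X) (hZ : Measurable Z)
    (hXZ : IndepFun X Z P) (F : α → β → ℝ) :
    ∫ ξ, F (X ξ) (Z ξ) ∂P = ∫ ξ, ∫ ξ', F (X ξ) (Z ξ') ∂P ∂P := by
  have := Measure.isProbabilityMeasure_map (μ := P) hX.aemeasurable
  have := Measure.isProbabilityMeasure_map (μ := P) hZ.aemeasurable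
  have hpair := (indepFun_iff_map_prod_eq_prod_map_map hX.aemeasurable hZ.aemeasurable).1 hXZ
  calc ∫ ξ, F (X ξ) (Z ξ) ∂P
      = ∫ y, F y.1 y.2 ∂(P.map fun ξ ↦ (X ξ, Z ξ)) :=
        (integral_map (hX.prodMk hZ).aemeasurable
          (measurable_of_finite fun y : α × β ↦ F y.1 y.2).aestronglyMeasurable).symm
    _ = ∫ x, ∫ z, F x z ∂(P.map Z) ∂(P.map X) := by
        rw [hpair, integral_prod (fun y : α × β ↦ F y.1 y.2) Integrable.of_finite]
    _ = ∫ ξ, ∫ z, F (X ξ) z ∂(P.map Z) ∂P :=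
        integral_map hX.aemeasurable (measurable_of_finite _).aestronglyMeasurable
    _ = ∫ ξ, ∫ ξ', F (X ξ) (Z ξ') ∂P ∂P := by
        congr with ξ
        exact integral_map hZ.aemeasurable (measurable_of_finite _).aestronglyMeasurable

lemma integral_le_of_integral_sq_le {N : Ω → ℝ} (hN : MemLp N 2 P) {ε : ℝ} (hε : 0 ≤ ε)
    (h : ∫ ξ, N ξ ^ 2 ∂P ≤ ε ^ 2) : ∫ ξ, N ξ ∂P ≤ ε := by
  have hvar := variance_nonneg N P
  rw [variance_eq_sub hN] at hvar
  exact le_of_abs_le (abs_le_of_sq_le_sq ((sub_nonneg.1 hvar).trans h) hε)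

end FiniteRandomVariables

section DrivenOrbit

variable {α β : Type*}

/-- The orbit of `a` under the recursion `x_{k+1} = Φ x_k z_k` driven by the inputs `z`. For
independent random inputs this is a Markov chain. -/
def drivenOrbit (Φ : α → β → α) (a : α) (z : ℕ → β) : ℕ → α
  | 0 => a
  | k + 1 => Φ (drivenOrbit Φ a z k) (z k)

lemma drivenOrbit_congr (Φ : α → β → α) (a : α) {z z' : ℕ → β} {k : ℕ}
    (h : ∀ i < k, z i = z' i) : drivenOrbit Φ a z k = drivenOrbit Φ a z' k := by
  induction k with
  | zero => rfl
  | succ k ih =>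
    rw [drivenOrbit, drivenOrbit, ih fun i hi ↦ h i (hi.trans k.lt_succ_self), h k k.lt_succ_self]

lemma exists_drivenOrbit_eq_comp_restrict [Nonempty β] (Φ : α → β → α) (a : α) (m : ℕ) :
    ∃ x : (Finset.range m → β) → ℕ → α,
      ∀ z : ℕ → β, ∀ k ≤ m, drivenOrbit Φ a z k = x (fun i ↦ z i) k := by
  obtain ⟨d⟩ := ‹Nonempty β›
  refine ⟨fun y ↦ drivenOrbit Φ a (Function.extend Subtype.val y fun _ ↦ d), fun z k hk ↦
    drivenOrbit_congr Φ a fun i hi ↦ ?_⟩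
  exact (Subtype.val_injective.extend_apply (fun i : Finset.range m ↦ z i) _
    ⟨i, Finset.mem_range.2 (hi.trans_le hk)⟩).symm

variable {Ω : Type*} [MeasurableSpace Ω] {P : Measure Ω} [IsProbabilityMeasure P]
  [Finite β] [Nonempty β] [MeasurableSpace β] [DiscreteMeasurableSpace β] {Z : ℕ → Ω → β}

lemma integrable_drivenOrbit (hZ : ∀ k, Measurable (Z k)) (Φ : α → β → α) (a : α) (k : ℕ)
    (h : α → ℝ) : Integrable (fun ξ ↦ h (drivenOrbit Φ a (fun i ↦ Z i ξ) k)) P := by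
  obtain ⟨x, hx⟩ := exists_drivenOrbit_eq_comp_restrict Φ a k
  simp only [fun ξ ↦ hx (fun i ↦ Z i ξ) k le_rfl]
  exact integrable_comp_of_finite (measurable_pi_lambda (fun ξ (i : Finset.range k) ↦ Z i ξ)
    fun i ↦ hZ i) fun y ↦ h (x y k)

lemma integral_drivenOrbit_succ (hZ : ∀ k, Measurable (Z k)) (hind : iIndepFun Z P)
    (Φ : α → β → α) (a : α) (k : ℕ) (V : α → ℝ) :
    ∫ ξ, V (drivenOrbit Φ a (fun i ↦ Z i ξ) (k + 1)) ∂P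
      = ∫ ξ, ∫ ξ', V (Φ (drivenOrbit Φ a (fun i ↦ Z i ξ) k) (Z k ξ')) ∂P ∂P := by
  obtain ⟨x, hx⟩ := exists_drivenOrbit_eq_comp_restrict Φ a k
  have hpast : Measurable fun ξ (i : Finset.range k) ↦ Z i ξ :=
    measurable_pi_lambda _ fun i ↦ hZ i
  have hindep : IndepFun (fun ξ (i : Finset.range k) ↦ Z i ξ) (Z k) P :=
    (hind.indepFun_finset (Finset.range k) {k} (by simp) hZ).comp (φ := id)
      (ψ := fun y : ({k} : Finset ℕ) → β ↦ y ⟨k, Finset.mem_singleton_self k⟩)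
      measurable_id (measurable_pi_apply _)
  simp only [drivenOrbit, fun ξ ↦ hx (fun i ↦ Z i ξ) k le_rfl]
  exact integral_comp_indepFun hpast (hZ k) hindep fun y z ↦ V (Φ (x y k) z)

lemma sum_integral_drivenOrbit_le (hZ : ∀ k, Measurable (Z k)) (hind : iIndepFun Z P)
    {Φ : α → β → α} {V W : α → ℝ} (hV : ∀ a, 0 ≤ V a)
    (hdrift : ∀ k a, ∫ ξ, V (Φ a (Z k ξ)) ∂P ≤ V a - W a) (a : α) (m : ℕ) :
    ∑ k ∈ Finset.range m, ∫ ξ, W (drivenOrbit Φ a (fun i ↦ Z i ξ) k) ∂P ≤ V a := by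
  let v (k : ℕ) : ℝ := ∫ ξ, V (drivenOrbit Φ a (fun i ↦ Z i ξ) k) ∂P
  have hstep (k : ℕ) : ∫ ξ, W (drivenOrbit Φ a (fun i ↦ Z i ξ) k) ∂P ≤ v k - v (k + 1) := by
    have hVk := integrable_drivenOrbit (P := P) hZ Φ a k V
    have hWk := integrable_drivenOrbit (P := P) hZ Φ a k W
    rw [le_sub_comm, ← integral_sub hVk hWk]
    refine (integral_drivenOrbit_succ hZ hind Φ a k V).trans_le (integral_mono ?_ (hVk.sub hWk)
      fun ξ ↦ hdrift k _)
    exact integrable_drivenOrbit hZ Φ a k fun a' ↦ ∫ ξ', V (Φ a' (Z k ξ')) ∂P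
  calc ∑ k ∈ Finset.range m, ∫ ξ, W (drivenOrbit Φ a (fun i ↦ Z i ξ) k) ∂P
      ≤ ∑ k ∈ Finset.range m, (v k - v (k + 1)) := Finset.sum_le_sum fun k _ ↦ hstep k
    _ = v 0 - v m := Finset.sum_range_sub' v m
    _ ≤ v 0 := sub_le_self _ (integral_nonneg fun ξ ↦ hV _)
    _ = V a := by simp only [v, drivenOrbit, integral_const, probReal_univ, one_smul]

variable {K : ℕ} {J : Ω → Fin K}

lemma integrable_drivenOrbit_index (hZ : ∀ k, Measurable (Z k)) (hJ : Measurable J)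
    (Φ : α → β → α) (a : α) (h : α → ℝ) :
    Integrable (fun ξ ↦ h (drivenOrbit Φ a (fun i ↦ Z i ξ) (J ξ))) P := by
  obtain ⟨x, hx⟩ := exists_drivenOrbit_eq_comp_restrict Φ a K
  simp only [fun ξ ↦ hx (fun i ↦ Z i ξ) (J ξ) (J ξ).2.le]
  exact integrable_comp_of_finite ((measurable_pi_lambda (fun ξ (i : Finset.range K) ↦ Z i ξ)
    fun i ↦ hZ i).prodMk hJ) fun y ↦ h (x y.1 y.2)

lemma integral_drivenOrbit_index (hZ : ∀ k, Measurable (Z k)) (hJ : Measurable J)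
    (hlaw : ∀ j, P.real {ξ | J ξ = j} = 1 / (K : ℝ)) (hind : IndepFun J (fun ξ k ↦ Z k ξ) P)
    (Φ : α → β → α) (a : α) (h : α → ℝ) :
    ∫ ξ, h (drivenOrbit Φ a (fun i ↦ Z i ξ) (J ξ)) ∂P
      = (∑ k ∈ Finset.range K, ∫ ξ, h (drivenOrbit Φ a (fun i ↦ Z i ξ) k) ∂P) / K := by
  obtain ⟨x, hx⟩ := exists_drivenOrbit_eq_comp_restrict Φ a K
  have hpast : Measurable fun ξ (i : Finset.range K) ↦ Z i ξ :=
    measurable_pi_lambda _ fun i ↦ hZ i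
  have hindep : IndepFun J (fun ξ (i : Finset.range K) ↦ Z i ξ) P :=
    hind.comp (φ := id) (ψ := fun (z : ℕ → β) (i : Finset.range K) ↦ z i) measurable_id
      (measurable_pi_lambda _ fun _ ↦ measurable_pi_apply _)
  simp only [fun ξ ↦ hx (fun i ↦ Z i ξ) (J ξ) (J ξ).2.le]
  rw [integral_comp_indepFun hJ hpast hindep fun j y ↦ h (x y j),
    integral_comp_eq_sum hJ fun j ↦ ∫ ξ, h (x (fun i ↦ Z i ξ) j) ∂P, Finset.sum_div,
    Finset.sum_range]
  refine Finset.sum_congr rfl fun j _ ↦ ?_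
  simp only [hlaw, one_div_mul_eq_div, fun ξ ↦ hx (fun i ↦ Z i ξ) j j.2.le]

end DrivenOrbit

section Step

open Finset

variable {E : Type*} [NormedAddCommGroup E] [NormedSpace ℝ E]
  {M : Type*} [TopologicalSpace M] [ChartedSpace E M]
  [RiemannianBundle (fun x : M ↦ TangentSpace 𝓘(ℝ, E) x)]

lemma isGeodesicFrom_expCurve [IsManifold 𝓘(ℝ, E) ∞ M] (hM : IsGeodesicallyComplete E M)
    (xv : TangentBundle 𝓘(ℝ, E) M) : IsGeodesicFrom (expCurve xv) xv := by
  rw [expCurve, dif_pos (hM xv)]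
  exact (hM xv).choose_spec

variable [FiniteDimensional ℝ E] {n b : ℕ}

/-- The squared error `‖g - ∇f(x)‖²` of the gradient estimate in the state `(x, g)`. -/
def gradError (f : Fin n → M → ℝ) (s : TangentBundle 𝓘(ℝ, E) M) : ℝ :=
  ‖s.snd - batchGrad f univ s.proj‖ ^ 2

lemma gradError_batchGrad_univ (f : Fin n → M → ℝ) (x : M) :
    gradError (E := E) f ⟨x, batchGrad f univ x⟩ = 0 := by
  rw [gradError, sub_self, norm_zero, zero_pow two_ne_zero]

/-- The Lyapunov function `f(x) - f* + η / (2p) ‖g - ∇f(x)‖²` of R-PAGE. -/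
def potential (f : Fin n → M → ℝ) (fstar η p : ℝ) (s : TangentBundle 𝓘(ℝ, E) M) : ℝ :=
  objective f s.proj - fstar + η / (2 * p) * gradError f s

lemma potential_nonneg {f : Fin n → M → ℝ} {fstar η p : ℝ}
    (hfstar : ∀ x, fstar ≤ objective f x) (hη : 0 ≤ η) (hp : 0 ≤ p)
    (s : TangentBundle 𝓘(ℝ, E) M) : 0 ≤ potential f fstar η p s :=
  add_nonneg (sub_nonneg.2 (hfstar s.proj)) (mul_nonneg (by positivity) (sq_nonneg _))

variable [IsManifold 𝓘(ℝ, E) ∞ M]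

/-- One iteration `(x^k, g^k) ↦ (x^{k+1}, g^{k+1})` of R-PAGE, for a given outcome of the coin
and of the minibatch. -/
def pageStep (f : Fin n → M → ℝ) (η : ℝ) (s : TangentBundle 𝓘(ℝ, E) M)
    (z : Bool × Finset (Fin n)) : TangentBundle 𝓘(ℝ, E) M :=
  let step : TangentBundle 𝓘(ℝ, E) M := ⟨s.proj, -(η • s.snd)⟩
  let y : M := riemExp step
  let transport : TangentBundle 𝓘(ℝ, E) M → TangentSpace 𝓘(ℝ, E) y :=
    parallelTransport (expCurve step) 0 1
  ⟨y, if z.1 then batchGrad f univ y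
      else transport s + batchGrad f z.2 y - transport ⟨s.proj, batchGrad f z.2 s.proj⟩⟩

lemma iterate_eq_drivenOrbit (f : Fin n → M → ℝ) (η : ℝ) (x₀ : M) (coin : ℕ → Bool)
    (batch : ℕ → Finset (Fin n)) (k : ℕ) :
    iterate (E := E) f η x₀ coin batch k
      = drivenOrbit (pageStep f η) ⟨x₀, batchGrad f univ x₀⟩ (fun i ↦ (coin i, batch i)) k := by
  induction k with
  | zero => rfl
  | succ k ih => rw [drivenOrbit, ← ih]; rfl

lemma gradError_pageStep_true (f : Fin n → M → ℝ) (η : ℝ) (s : TangentBundle 𝓘(ℝ, E) M)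
    (S : Finset (Fin n)) : gradError f (pageStep f η s (true, S)) = 0 :=
  gradError_batchGrad_univ f _

variable [IsContMDiffRiemannianBundle 𝓘(ℝ, E) 1 E (fun x : M ↦ TangentSpace 𝓘(ℝ, E) x)]
  {f : Fin n → M → ℝ} {L : ℝ}

lemma objective_pageStep_le (hM : IsGeodesicallyComplete E M) (hn : n ≠ 0)
    (hf : ∀ i, IsGSmooth E L (f i)) (η : ℝ) (s : TangentBundle 𝓘(ℝ, E) M)
    (z : Bool × Finset (Fin n)) :
    objective f (pageStep f η s z).proj ≤ objective f s.proj
      - η / 2 * ‖batchGrad (E := E) f univ s.proj‖ ^ 2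
      - η / 2 * (1 - L * η) * ‖s.snd‖ ^ 2 + η / 2 * gradError f s := by
  obtain ⟨x, g⟩ := s
  have hdescent : objective f (expCurve ⟨x, -(η • g)⟩ 1) ≤ objective f x
      - η * inner ℝ (batchGrad f univ x) g + L * η ^ 2 * ‖g‖ ^ 2 / 2 := by
    obtain ⟨hγ, h0⟩ := isGeodesicFrom_expCurve hM ⟨x, -(η • g)⟩
    generalize hv : -(η • g) = v at hγ h0 ⊢
    generalize expCurve ⟨x, v⟩ = γ at hγ h0 ⊢
    cases h0
    have h := objective_descent hn hf hγ
    rw [← hv, inner_neg_right, inner_smul_right, norm_neg, norm_smul, mul_pow, Real.norm_eq_abs,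
      sq_abs] at h
    linarith
  have hpolar : η * gradError f (⟨x, g⟩ : TangentBundle 𝓘(ℝ, E) M)
      = η * (‖g‖ ^ 2 - 2 * inner ℝ (batchGrad f univ x) g
        + ‖batchGrad (E := E) f univ x‖ ^ 2) := by
    rw [gradError, norm_sub_sq_real, real_inner_comm]
  change objective f (expCurve ⟨x, -(η • g)⟩ 1) ≤ objective f x
    - η / 2 * ‖batchGrad (E := E) f univ x‖ ^ 2 - η / 2 * (1 - L * η) * ‖g‖ ^ 2
    + η / 2 * gradError f (⟨x, g⟩ : TangentBundle 𝓘(ℝ, E) M)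
  linarith

lemma expect_norm_update_error_sq_le (hn : n ≠ 0) (hb : 1 ≤ b) (hf : ∀ i, IsGSmooth E L (f i))
    {γ : ℝ → M} (hγ : IsGeodesic (E := E) γ) (g : TangentSpace 𝓘(ℝ, E) (γ 0)) :
    𝔼 S ∈ powersetCard b univ, ‖transportEquiv hγ.contMDiff_one 0 1 g + batchGrad f S (γ 1)
        - transportEquiv hγ.contMDiff_one 0 1 (batchGrad f S (γ 0)) - batchGrad f univ (γ 1)‖ ^ 2
      ≤ ‖g - batchGrad f univ (γ 0)‖ ^ 2 + (L * ‖velocity (E := E) γ 0‖) ^ 2 / b := by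
  set T := transportEquiv hγ.contMDiff_one 0 1
  let X (i : Fin n) : TangentSpace 𝓘(ℝ, E) (γ 1) :=
    riemGrad (f i) (γ 1) - T (riemGrad (f i) (γ 0))
  have hmean (S : Finset (Fin n)) :
      (#S : ℝ)⁻¹ • ∑ i ∈ S, X i = batchGrad f S (γ 1) - T (batchGrad f S (γ 0)) := by
    simp only [X, batchGrad, sum_sub_distrib, smul_sub, map_smul, map_sum]
  have hX : 𝔼 i, ‖X i‖ ^ 2 ≤ (L * ‖velocity (E := E) γ 0‖) ^ 2 := by
    have : NeZero n := ⟨hn⟩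
    refine expect_le univ_nonempty fun i _ ↦ ?_
    gcongr
    exact (hf i).norm_sub_transport_le hγ
  have herror (S : Finset (Fin n)) :
      T g + batchGrad f S (γ 1) - T (batchGrad f S (γ 0)) - batchGrad f univ (γ 1)
        = T (g - batchGrad f univ (γ 0))
          + ((#S : ℝ)⁻¹ • ∑ i ∈ S, X i - (#(univ : Finset (Fin n)) : ℝ)⁻¹ • ∑ i, X i) := by
    rw [hmean, hmean, map_sub]
    abel
  simp only [herror]
  refine (expect_norm_add_sampling_error_sq_le hb X univ _).trans ?_
  rw [T.norm_map]
  gcongr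

lemma expect_gradError_pageStep_false_le (hM : IsGeodesicallyComplete E M) (hn : n ≠ 0)
    (hb : 1 ≤ b) (hf : ∀ i, IsGSmooth E L (f i)) (η : ℝ) (s : TangentBundle 𝓘(ℝ, E) M) :
    𝔼 S ∈ powersetCard b univ, gradError f (pageStep f η s (false, S))
      ≤ gradError f s + (L * η) ^ 2 / b * ‖s.snd‖ ^ 2 := by
  obtain ⟨x, g⟩ := s
  obtain ⟨hγ, h0⟩ := isGeodesicFrom_expCurve hM ⟨x, -(η • g)⟩
  have hstep (S : Finset (Fin n)) : gradError f (pageStep f η ⟨x, g⟩ (false, S))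
      = ‖parallelTransport (expCurve ⟨x, -(η • g)⟩) 0 1 ⟨x, g⟩
          + batchGrad f S (expCurve ⟨x, -(η • g)⟩ 1)
          - parallelTransport (expCurve ⟨x, -(η • g)⟩) 0 1 ⟨x, batchGrad f S x⟩
          - batchGrad f univ (expCurve ⟨x, -(η • g)⟩ 1)‖ ^ 2 := rfl
  simp only [hstep]
  change _ ≤ ‖g - batchGrad f univ x‖ ^ 2 + (L * η) ^ 2 / b * ‖g‖ ^ 2
  generalize hv : -(η • g) = v at hγ h0 ⊢
  generalize expCurve ⟨x, v⟩ = γ at hγ h0 ⊢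
  cases h0
  refine (expect_norm_update_error_sq_le hn hb hf hγ g).trans_eq ?_
  rw [← hv, norm_neg, norm_smul, Real.norm_eq_abs, mul_pow, mul_pow, sq_abs]
  ring

end Step

section Randomness

variable {Ω : Type*} [MeasurableSpace Ω] {P : Measure Ω} {n b K : ℕ} {p : ℝ}
  {coin : ℕ → Ω → Bool} {batch : ℕ → Ω → Finset (Fin n)} {idx : Ω → Fin K}

lemma IsRandomness.measurable_outcome (h : IsRandomness P n b K p coin batch idx) (k : ℕ) :
    Measurable fun ξ ↦ (coin k ξ, batch k ξ) :=
  (h.measurable_coin k).prodMk (h.measurable_batch k)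

variable [IsProbabilityMeasure P]

lemma IsRandomness.probability_le_one (h : IsRandomness P n b K p coin batch idx) : p ≤ 1 :=
  h.coin_law 0 ▸ measureReal_le_one

lemma IsRandomness.integral_coin (h : IsRandomness P n b K p coin batch idx) (k : ℕ)
    (G : Bool → ℝ) : ∫ ξ, G (coin k ξ) ∂P = p * G true + (1 - p) * G false := by
  have hfalse : {ξ | coin k ξ = false} = {ξ | coin k ξ = true}ᶜ := by
    ext ξ
    simp only [Set.mem_ofPred_eq, Set.mem_compl_iff, Bool.not_eq_true]
  have htrue : MeasurableSet {ξ | coin k ξ = true} :=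
    h.measurable_coin k (measurableSet_singleton true)
  rw [integral_comp_eq_sum (h.measurable_coin k), Fintype.sum_bool, hfalse,
    probReal_compl_eq_one_sub htrue, h.coin_law]

lemma IsRandomness.integral_batch (h : IsRandomness P n b K p coin batch idx) (k : ℕ)
    (G : Finset (Fin n) → ℝ) :
    ∫ ξ, G (batch k ξ) ∂P = 𝔼 S ∈ Finset.powersetCard b Finset.univ, G S := by
  have hzero (S : Finset (Fin n)) (hS : S ∉ Finset.powersetCard b Finset.univ) :
      P.real {ξ | batch k ξ = S} = 0 := by
    rw [measureReal_eq_zero_iff, measure_eq_zero_iff_ae_notMem]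
    filter_upwards [h.batch_card k] with ξ hcard hξ
    obtain rfl : batch k ξ = S := hξ
    exact hS (Finset.mem_powersetCard.2 ⟨Finset.subset_univ _, hcard⟩)
  rw [integral_comp_eq_sum (h.measurable_batch k), Finset.expect_eq_sum_div_card,
    Finset.card_powersetCard, Finset.card_univ, Fintype.card_fin, Finset.sum_div,
    ← Finset.sum_subset (Finset.subset_univ _) fun S _ hS ↦ by rw [hzero S hS, zero_mul]]
  refine Finset.sum_congr rfl fun S hS ↦ ?_
  rw [h.batch_law k S (Finset.mem_powersetCard.1 hS).2, one_div_mul_eq_div]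

lemma IsRandomness.integral_outcome (h : IsRandomness P n b K p coin batch idx) (k : ℕ)
    (G : Bool × Finset (Fin n) → ℝ) :
    ∫ ξ, G (coin k ξ, batch k ξ) ∂P
      = p * 𝔼 S ∈ Finset.powersetCard b Finset.univ, G (true, S)
        + (1 - p) * 𝔼 S ∈ Finset.powersetCard b Finset.univ, G (false, S) := by
  rw [integral_comp_indepFun (h.measurable_coin k) (h.measurable_batch k) (h.indep_coin_batch k)
    fun c S ↦ G (c, S)]
  refine (integral_congr_ae (.of_forall fun ξ ↦ ?_)).trans (h.integral_coin k fun c ↦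
    𝔼 S ∈ Finset.powersetCard b Finset.univ, G (c, S))
  exact h.integral_batch k fun S ↦ G (coin k ξ, S)

lemma natCast_gradCount (n b : ℕ) (coin : ℕ → Bool) (m : ℕ) :
    (gradCount n b coin m : ℝ)
      = n + ∑ k ∈ Finset.range m, if coin k then (n : ℝ) else 2 * b := by
  simp only [gradCount, Nat.cast_add, Nat.cast_sum, Nat.cast_ite, Nat.cast_mul, Nat.cast_ofNat]

lemma IsRandomness.integrable_gradCount (h : IsRandomness P n b K p coin batch idx) (m : ℕ) :
    Integrable (fun ξ ↦ (gradCount n b (fun k ↦ coin k ξ) m : ℝ)) P := by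
  simp only [natCast_gradCount]
  exact (integrable_const _).add (integrable_finsetSum _ fun k _ ↦
    integrable_comp_of_finite (h.measurable_coin k) fun c ↦ if c then (n : ℝ) else 2 * b)

lemma IsRandomness.integral_gradCount (h : IsRandomness P n b K p coin batch idx) (m : ℕ) :
    ∫ ξ, (gradCount n b (fun k ↦ coin k ξ) m : ℝ) ∂P
      = n + m * (p * n + (1 - p) * (2 * b)) := by
  let cost (c : Bool) : ℝ := if c then n else 2 * b
  have hint (k : ℕ) : Integrable (fun ξ ↦ cost (coin k ξ)) P :=
    integrable_comp_of_finite (h.measurable_coin k) cost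
  have hcost (k : ℕ) : ∫ ξ, cost (coin k ξ) ∂P = p * n + (1 - p) * (2 * b) := by
    simp only [h.integral_coin k cost, cost, if_true, Bool.false_eq_true, if_false]
  calc ∫ ξ, (gradCount n b (fun k ↦ coin k ξ) m : ℝ) ∂P
      = ∫ ξ, (n + ∑ k ∈ Finset.range m, cost (coin k ξ) : ℝ) ∂P := by
        simp only [natCast_gradCount, cost]
    _ = n + ∑ k ∈ Finset.range m, ∫ ξ, cost (coin k ξ) ∂P := by
        rw [integral_add (integrable_const _) (integrable_finsetSum _ fun k _ ↦ hint k),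
          integral_finsetSum _ fun k _ ↦ hint k, integral_const, probReal_univ, one_smul]
    _ = n + m * (p * n + (1 - p) * (2 * b)) := by
        simp only [hcost, Finset.sum_const, Finset.card_range, nsmul_eq_mul]

end Randomness

section Convergence

variable {E : Type*} [NormedAddCommGroup E] [NormedSpace ℝ E] [FiniteDimensional ℝ E]
  {M : Type*} [TopologicalSpace M] [ChartedSpace E M] [IsManifold 𝓘(ℝ, E) ∞ M]
  [RiemannianBundle (fun x : M ↦ TangentSpace 𝓘(ℝ, E) x)] {n b K : ℕ}

variable {Ω : Type*} [MeasurableSpace Ω] {P : Measure Ω} [IsProbabilityMeasure P] {p : ℝ}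
  {coin : ℕ → Ω → Bool} {batch : ℕ → Ω → Finset (Fin n)} {idx : Ω → Fin K}

lemma IsRandomness.memLp_output (h : IsRandomness P n b K p coin batch idx)
    (f : Fin n → M → ℝ) (η : ℝ) (x₀ : M) (N : M → ℝ) :
    MemLp (fun ξ ↦ N (output E f η x₀ (fun k ↦ coin k ξ) (fun k ↦ batch k ξ) (idx ξ))) 2 P := by
  simp only [output, iterate_eq_drivenOrbit]
  have hint (G : TangentBundle 𝓘(ℝ, E) M → ℝ) := integrable_drivenOrbit_index (P := P)
    h.measurable_outcome h.measurable_idx (pageStep f η) ⟨x₀, batchGrad f Finset.univ x₀⟩ G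
  rw [memLp_two_iff_integrable_sq (hint fun s ↦ N s.proj).1]
  exact hint fun s ↦ N s.proj ^ 2

lemma IsRandomness.integral_output (h : IsRandomness P n b K p coin batch idx)
    (f : Fin n → M → ℝ) (η : ℝ) (x₀ : M) (N : M → ℝ) :
    ∫ ξ, N (output E f η x₀ (fun k ↦ coin k ξ) (fun k ↦ batch k ξ) (idx ξ)) ∂P
      = (∑ k ∈ Finset.range K, ∫ ξ, N (drivenOrbit (pageStep (E := E) f η)
          ⟨x₀, batchGrad f Finset.univ x₀⟩ (fun i ↦ (coin i ξ, batch i ξ)) k).proj ∂P) / K := by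
  simp only [output, iterate_eq_drivenOrbit]
  exact integral_drivenOrbit_index h.measurable_outcome h.measurable_idx h.idx_law h.indep_idx
    (pageStep f η) _ fun s ↦ N s.proj

variable [IsContMDiffRiemannianBundle 𝓘(ℝ, E) 1 E (fun x : M ↦ TangentSpace 𝓘(ℝ, E) x)]
  {f : Fin n → M → ℝ} {L : ℝ}

lemma IsRandomness.integral_gradError_pageStep_le (h : IsRandomness P n b K p coin batch idx)
    (hM : IsGeodesicallyComplete E M) (hn : n ≠ 0) (hb : 1 ≤ b)
    (hf : ∀ i, IsGSmooth E L (f i)) (η : ℝ) (k : ℕ) (s : TangentBundle 𝓘(ℝ, E) M) :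
    ∫ ξ, gradError f (pageStep f η s (coin k ξ, batch k ξ)) ∂P
      ≤ (1 - p) * (gradError f s + (L * η) ^ 2 / b * ‖s.snd‖ ^ 2) := by
  rw [h.integral_outcome k fun z ↦ gradError f (pageStep f η s z)]
  simp only [gradError_pageStep_true, Finset.expect_const_zero, mul_zero, zero_add]
  exact mul_le_mul_of_nonneg_left (expect_gradError_pageStep_false_le hM hn hb hf η s)
    (sub_nonneg.2 h.probability_le_one)

lemma IsRandomness.integral_potential_pageStep_le (h : IsRandomness P n b K p coin batch idx)
    (hM : IsGeodesicallyComplete E M) (hn : n ≠ 0) (hb : 1 ≤ b)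
    (hf : ∀ i, IsGSmooth E L (f i)) (fstar : ℝ) {η : ℝ} (hη : 0 ≤ η) (hp : 0 < p)
    (hstep : (1 - p) / (p * b) * (L * η) ^ 2 ≤ 1 - L * η) (k : ℕ)
    (s : TangentBundle 𝓘(ℝ, E) M) :
    ∫ ξ, potential f fstar η p (pageStep f η s (coin k ξ, batch k ξ)) ∂P
      ≤ potential f fstar η p s - η / 2 * ‖batchGrad (E := E) f Finset.univ s.proj‖ ^ 2 := by
  have hint : Integrable (fun ξ ↦ gradError f (pageStep f η s (coin k ξ, batch k ξ))) P :=
    integrable_comp_of_finite (h.measurable_outcome k) fun z ↦ gradError f (pageStep f η s z)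
  have hpot : Integrable (fun ξ ↦ potential f fstar η p (pageStep f η s (coin k ξ, batch k ξ))) P :=
    integrable_comp_of_finite (h.measurable_outcome k)
      fun z ↦ potential f fstar η p (pageStep f η s z)
  set D := objective f s.proj - η / 2 * ‖batchGrad (E := E) f Finset.univ s.proj‖ ^ 2
    - η / 2 * (1 - L * η) * ‖s.snd‖ ^ 2 + η / 2 * gradError f s - fstar
  have hslack : (1 - p) / (p * b) * (L * η) ^ 2 * (η / 2 * ‖s.snd‖ ^ 2)
      ≤ (1 - L * η) * (η / 2 * ‖s.snd‖ ^ 2) := by gcongr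
  calc ∫ ξ, potential f fstar η p (pageStep f η s (coin k ξ, batch k ξ)) ∂P
      ≤ ∫ ξ, (D + η / (2 * p) * gradError f (pageStep f η s (coin k ξ, batch k ξ))) ∂P := by
        refine integral_mono hpot ((integrable_const D).add (hint.const_mul _)) fun ξ ↦ ?_
        exact add_le_add_left (sub_le_sub_right (objective_pageStep_le hM hn hf η s _) fstar) _
    _ = D + η / (2 * p) * ∫ ξ, gradError f (pageStep f η s (coin k ξ, batch k ξ)) ∂P := by
        rw [integral_add (integrable_const D) (hint.const_mul _), integral_const_mul,
          integral_const, probReal_univ, one_smul]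
    _ ≤ D + η / (2 * p) * ((1 - p) * (gradError f s + (L * η) ^ 2 / b * ‖s.snd‖ ^ 2)) := by
        gcongr
        exact h.integral_gradError_pageStep_le hM hn hb hf η k s
    _ = D + η / (2 * p) * gradError f s - η / 2 * gradError f s
          + (1 - p) / (p * b) * (L * η) ^ 2 * (η / 2 * ‖s.snd‖ ^ 2) := by
        field_simp
        ring
    _ ≤ potential f fstar η p s - η / 2 * ‖batchGrad (E := E) f Finset.univ s.proj‖ ^ 2 := by
        simp only [potential, D]
        linarith

lemma IsRandomness.integral_norm_sq_output_le (h : IsRandomness P n b K p coin batch idx)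
    (hM : IsGeodesicallyComplete E M) (hn : n ≠ 0) (hb : 1 ≤ b)
    (hf : ∀ i, IsGSmooth E L (f i)) {fstar : ℝ} (hfstar : ∀ x, fstar ≤ objective f x)
    {η : ℝ} (hη : 0 < η) (hp : 0 < p)
    (hstep : (1 - p) / (p * b) * (L * η) ^ 2 ≤ 1 - L * η) (x₀ : M) :
    ∫ ξ, ‖riemGrad (E := E) (objective f)
        (output E f η x₀ (fun k ↦ coin k ξ) (fun k ↦ batch k ξ) (idx ξ))‖ ^ 2 ∂P
      ≤ 2 * (objective f x₀ - fstar) / η / K := by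
  refine (h.integral_output f η x₀ fun x ↦ ‖riemGrad (objective f) x‖ ^ 2).trans_le ?_
  have hsum := sum_integral_drivenOrbit_le h.measurable_outcome h.indep_iterations
    (potential_nonneg hfstar hη.le hp.le)
    (h.integral_potential_pageStep_le hM hn hb hf fstar hη.le hp hstep)
    ⟨x₀, batchGrad f Finset.univ x₀⟩ K
  simp only [integral_const_mul, ← Finset.mul_sum, potential, gradError_batchGrad_univ, mul_zero,
    add_zero] at hsum
  simp only [riemGrad_objective fun i ↦ (hf i).1]
  gcongr
  rw [le_div_iff₀ hη]
  linarith

end Convergence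

section Parameters

variable {n b p L δ η ε : ℝ}

lemma one_sub_div_mul_eq (hn : 0 < n) (hb : 0 < b) (hp : p = b / (n + b)) :
    (1 - p) / (p * b) = (√n / b) ^ 2 := by
  rw [div_pow, Real.sq_sqrt hn.le, hp]
  field_simp
  ring

lemma sq_mul_sq_le_one_sub {r : ℝ} (hL : 0 < L) (hr : 0 ≤ r) (hη : η = 1 / (L * (1 + r))) :
    r ^ 2 * (L * η) ^ 2 ≤ 1 - L * η := by
  have hLη : L * η = 1 / (1 + r) := by
    rw [hη]
    field_simp
  have hgap : 1 - 1 / (1 + r) - r ^ 2 * (1 / (1 + r)) ^ 2 = r / (1 + r) ^ 2 := by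
    field_simp
    ring
  rw [hLη, ← sub_nonneg, hgap]
  positivity

lemma expected_cost_le (hn : 0 < n) (hb : 0 < b) (hp : p = b / (n + b)) :
    p * n + (1 - p) * (2 * b) ≤ 3 * b := by
  have hcost : p * n + (1 - p) * (2 * b) = 3 * b * (n / (n + b)) := by
    rw [hp]
    field_simp
    ring
  rw [hcost]
  exact mul_le_of_le_one_right (by positivity) ((div_le_one (by positivity)).2 (by linarith))

lemma iteration_bound_le (hb : 0 < b) (hbn : b ≤ √n) (hL : 0 < L) (hδ : 0 ≤ δ)
    (hη : η = 1 / (L * (1 + √n / b))) :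
    2 * δ / η / ε ^ 2 ≤ 4 * (L * δ * √n / ε ^ 2) / b := by
  have hcount : 2 * δ / η / ε ^ 2 = 2 * (L * δ / ε ^ 2) / b * (b + √n) := by
    rw [hη]
    field_simp
  calc 2 * δ / η / ε ^ 2 = 2 * (L * δ / ε ^ 2) / b * (b + √n) := hcount
    _ ≤ 2 * (L * δ / ε ^ 2) / b * (√n + √n) := by gcongr
    _ = 4 * (L * δ * √n / ε ^ 2) / b := by ring

lemma total_cost_le {K : ℝ} (hb : 1 ≤ b) (hbn : b ≤ √n) (hL : 0 < L) (hδ : 0 ≤ δ)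
    (hp : p = b / (n + b)) (hη : η = 1 / (L * (1 + √n / b)))
    (hK0 : 0 ≤ K) (hK : K ≤ 2 * δ / η / ε ^ 2 + 1) :
    n + K * (p * n + (1 - p) * (2 * b)) ≤ 12 * (n + L * δ * √n / ε ^ 2) := by
  have hb0 : 0 < b := one_pos.trans_le hb
  have hn : 1 ≤ n := Real.one_le_sqrt.1 (hb.trans hbn)
  have hsqrt : √n ≤ n := (Real.sqrt_le_left (by linarith)).2 (le_self_pow₀ hn two_ne_zero)
  calc n + K * (p * n + (1 - p) * (2 * b)) ≤ n + K * (3 * b) := by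
        gcongr
        exact expected_cost_le (by linarith) hb0 hp
    _ ≤ n + (4 * (L * δ * √n / ε ^ 2) / b + 1) * (3 * b) := by
        gcongr
        exact hK.trans (add_le_add_left (iteration_bound_le hb0 hbn hL hδ hη) 1)
    _ = n + 3 * b + 12 * (L * δ * √n / ε ^ 2) := by
        field_simp
        ring
    _ ≤ 12 * (n + L * δ * √n / ε ^ 2) := by linarith

end Parameters

end RPAGE

end

theorem corollary5_general
    {E : Type*} [NormedAddCommGroup E] [NormedSpace ℝ E] [FiniteDimensional ℝ E]
    {M : Type*} [TopologicalSpace M] [ChartedSpace E M] [IsManifold 𝓘(ℝ, E) ∞ M]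
    [RiemannianBundle (fun x : M ↦ TangentSpace 𝓘(ℝ, E) x)]
    [IsContMDiffRiemannianBundle 𝓘(ℝ, E) 1 E (fun x : M ↦ TangentSpace 𝓘(ℝ, E) x)]
    (hM : RPAGE.IsGeodesicallyComplete E M)
    {n b : ℕ} (hb : 1 ≤ b) (hbn : (b : ℝ) ≤ √(n : ℝ))
    (f : Fin n → M → ℝ) {L : ℝ} (hL : 0 < L) (hf : ∀ i, RPAGE.IsGSmooth E L (f i))
    {fstar : ℝ} (hfstar : ∀ x, fstar ≤ RPAGE.objective f x)
    (x₀ : M) {ε : ℝ} (hε : 0 < ε)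
    {p η : ℝ} (hp : p = (b : ℝ) / ((n : ℝ) + b))
    (hη : η = 1 / (L * (1 + √((1 - p) / (p * b))))) :
    ∃ K : ℕ, 0 < K ∧
      ∀ {Ω : Type*} [MeasurableSpace Ω] (P : Measure Ω) [IsProbabilityMeasure P]
        (coin : ℕ → Ω → Bool) (batch : ℕ → Ω → Finset (Fin n)) (idx : Ω → Fin K),
        RPAGE.IsRandomness P n b K p coin batch idx →
        (Integrable (fun ξ ↦ ‖RPAGE.riemGrad (E := E) (RPAGE.objective f)
            (RPAGE.output E f η x₀ (fun k ↦ coin k ξ) (fun k ↦ batch k ξ) (idx ξ))‖) P ∧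
          ∫ ξ, ‖RPAGE.riemGrad (E := E) (RPAGE.objective f)
            (RPAGE.output E f η x₀ (fun k ↦ coin k ξ) (fun k ↦ batch k ξ) (idx ξ))‖ ∂P ≤ ε) ∧
        (Integrable (fun ξ ↦ (RPAGE.gradCount n b (fun k ↦ coin k ξ) K : ℝ)) P ∧
          ∫ ξ, (RPAGE.gradCount n b (fun k ↦ coin k ξ) K : ℝ) ∂P ≤
            12 * ((n : ℝ) + L * (RPAGE.objective f x₀ - fstar) * √(n : ℝ) / ε ^ 2)) := by
  have hb1 : (1 : ℝ) ≤ b := by exact_mod_cast hb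
  have hn1 : (1 : ℝ) ≤ n := Real.one_le_sqrt.1 (hb1.trans hbn)
  have hn : n ≠ 0 := by exact_mod_cast (one_pos.trans_le hn1).ne'
  have hδ : 0 ≤ RPAGE.objective f x₀ - fstar := sub_nonneg.2 (hfstar x₀)
  have hp0 : 0 < p := by rw [hp]; positivity
  have hη0 : 0 < η := by rw [hη]; positivity
  have hratio := RPAGE.one_sub_div_mul_eq (one_pos.trans_le hn1) (one_pos.trans_le hb1) hp
  rw [hratio, Real.sqrt_sq (by positivity)] at hη
  have hstep : (1 - p) / (p * b) * (L * η) ^ 2 ≤ 1 - L * η :=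
    hratio ▸ RPAGE.sq_mul_sq_le_one_sub hL (by positivity) hη
  let C := 2 * (RPAGE.objective f x₀ - fstar) / η / ε ^ 2
  refine ⟨⌊C⌋₊ + 1, Nat.succ_pos _, fun P _ coin batch idx hR ↦ ⟨?_, ?_⟩⟩
  · have hN := hR.memLp_output (E := E) f η x₀ fun x ↦
      ‖RPAGE.riemGrad (E := E) (RPAGE.objective f) x‖
    refine ⟨hN.integrable one_le_two, RPAGE.integral_le_of_integral_sq_le hN hε.le ?_⟩
    refine (hR.integral_norm_sq_output_le hM hn hb hf hfstar hη0 hp0 hstep x₀).trans ?_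
    rw [div_le_comm₀ (by positivity) (by positivity), Nat.cast_add_one]
    exact (Nat.lt_floor_add_one C).le
  · refine ⟨hR.integrable_gradCount _, (hR.integral_gradCount _).trans_le ?_⟩
    refine RPAGE.total_cost_le hb1 hbn hL hδ hp hη (Nat.cast_nonneg _) ?_
    rw [Nat.cast_add_one]
    gcongr
    exact Nat.floor_le (by positivity)

theorem corollary5
    {E : Type*} [NormedAddCommGroup E] [NormedSpace ℝ E] [FiniteDimensional ℝ E]
    {M : Type*} [TopologicalSpace M] [T2Space M] [ChartedSpace E M] [IsManifold 𝓘(ℝ, E) ∞ M]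
    [RiemannianBundle (fun x : M ↦ TangentSpace 𝓘(ℝ, E) x)]
    [IsContMDiffRiemannianBundle 𝓘(ℝ, E) ∞ E (fun x : M ↦ TangentSpace 𝓘(ℝ, E) x)]
    (hM : RPAGE.IsGeodesicallyComplete E M)
    {n b : ℕ} (hb : 1 ≤ b) (hbn : (b : ℝ) ≤ √(n : ℝ))
    (f : Fin n → M → ℝ) {L : ℝ} (hL : 0 < L) (hf : ∀ i, RPAGE.IsGSmooth E L (f i))
    {fstar : ℝ} (hfstar : ∀ x, fstar ≤ RPAGE.objective f x)
    (x₀ : M) {ε : ℝ} (hε : 0 < ε)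
    {p η : ℝ} (hp : p = (b : ℝ) / ((n : ℝ) + b))
    (hη : η = 1 / (L * (1 + √((1 - p) / (p * b))))) :
    ∃ K : ℕ, 0 < K ∧
      ∀ {Ω : Type*} [MeasurableSpace Ω] (P : Measure Ω) [IsProbabilityMeasure P]
        (coin : ℕ → Ω → Bool) (batch : ℕ → Ω → Finset (Fin n)) (idx : Ω → Fin K),
        RPAGE.IsRandomness P n b K p coin batch idx →
        (Integrable (fun ξ ↦ ‖RPAGE.riemGrad (E := E) (RPAGE.objective f)
            (RPAGE.output E f η x₀ (fun k ↦ coin k ξ) (fun k ↦ batch k ξ) (idx ξ))‖) P ∧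
          ∫ ξ, ‖RPAGE.riemGrad (E := E) (RPAGE.objective f)
            (RPAGE.output E f η x₀ (fun k ↦ coin k ξ) (fun k ↦ batch k ξ) (idx ξ))‖ ∂P ≤ ε) ∧
        (Integrable (fun ξ ↦ (RPAGE.gradCount n b (fun k ↦ coin k ξ) K : ℝ)) P ∧
          ∫ ξ, (RPAGE.gradCount n b (fun k ↦ coin k ξ) K : ℝ) ∂P ≤
            12 * ((n : ℝ) + L * (RPAGE.objective f x₀ - fstar) * √(n : ℝ) / ε ^ 2)) := by
  have : IsContMDiffRiemannianBundle 𝓘(ℝ, E) 1 E (fun x : M ↦ TangentSpace 𝓘(ℝ, E) x) :=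
    .of_le (n := ∞) (by simp)
  exact corollary5_general hM hb hbn f hL hf hfstar x₀ hε hp hη
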